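/- \textbf{Setup.} For $p=1,2,\dots$ let $k=k(p)\in\{1,\dots,p\}$, $n=n(p)\in\{0,1,2,\dots\}$, $\sigma=\sigma(p)>0$, and let $(b_1,\dots,b_k)=(b_1^{(p)},\dots,b_k^{(p)})$ be a fixed vector of non-zero real numbers. Let $S$ be uniformly distributed on the $\binom pk$ subsets of $\{1,\dots,p\}$ of size $k$. Let $\beta\in\mathbb R^p$ vanish outside $S$, with the non-zero entries $\beta_S$ being a uniformly random permutation of $(b_1,\dots,b_k)$ (independent of $S$). Let $\mathbf X\in\mathbb R^{n\times p}$ have i.i.d. $N(0,1)$ entries, and let $\mathbf Y\in\mathbb R^n$ have entries $Y^{(i)}=\langle X^{(i)},\beta\rangle+Z^{(i)}$, where $X^{(i)}$ is the $i$-th row of $\mathbf X$ and $Z^{(1)},\dots,Z^{(n)}$ are i.i.d. $N(0,\sigma^2)$; the matrix, the noise and $(S,\beta)$ are independent. A decoder is a (deterministic, measurable) map $(\mathbf X,\mathbf Y)\mapsto\hat S\subseteq\{1,\dots,p\}$, which may depend on $p,k,n,\sigma$ and $(b_1,\dots,b_k)$, and its error probability is $P_e=\mathbb P[\hat S\ne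 S]$. Write $b_{\min}=\min_i|b_i|$, $b_{\max}=\max_i|b_i|$, and let $m_\beta$ be the number of distinct elements in $(b_1,\dots,b_k)$. All asymptotic notation refers to $p\to\infty$, and $\log$ is the natural logarithm. \textbf{Statement.} Suppose that $\sigma^2=\Theta(1)$, $b_{\min}=\Theta(b_{\max})$, $b_{\min}^2=O(1)$ and $k=o(p)$. \emph{Achievability.} Suppose that at least one of the following holds: (i) $k=\Theta(1)$; (ii) $k=o(\log p)$ and $m_\beta=\Theta(1)$; (iii) $k=O((\log p)^\theta)$ for some $\theta>0$, and $m_\beta=1$; (iv) $k=\Theta(p^\theta)$ for some $\theta\in(0,1)$, $b_{\min}^2=\Theta\big(\frac{\log k}{k}\big)$, and $m_\beta=1$. If, for some constant $\eta>0$ and all sufficiently large $p$, $$n\ \ge\ \max_{\emptyset\ne s_{\mathrm{dif}}\subseteq\{1,\dots,k\}}\ \frac{\log\binom{p-k}{|s_{\mathrm{dif}}|}}{\frac12\log\Big(1+\frac1{\sigma^2}\sum_{i\in s_{\mathrm{dif}}}b_i^2\Big)}\,(1+\eta),$$ then there is a sequence of decoders with $P_e\to0$ as $p\to\infty$. \emph{Strong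 converse.} Without any of the conditions (i)--(iv): if, for some constant $\eta>0$ and all sufficiently large $p$, $$n\ \le\ \max_{\emptyset\ne s_{\mathrm{dif}}\subseteq\{1,\dots,k\}}\ \frac{\log\binom{p-k+|s_{\mathrm{dif}}|}{|s_{\mathrm{dif}}|}}{\frac12\log\Big(1+\frac1{\sigma^2}\sum_{i\in s_{\mathrm{dif}}}b_i^2\Big)}\,(1-\eta),$$ then $P_e\to1$ as $p\to\infty$ for every sequence of decoders. -/

import Mathlib

open Filter Asymptotics MeasureTheory ProbabilityTheory
open scoped Topology

noncomputable section

namespace SupportRecovery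

/-- The finite set of all permutations carries the discrete σ-algebra (so does, by Mathlib's
instance, the finite set of all subsets of `{1, …, p}`). -/
instance instMeasurableSpacePermFin (k : ℕ) : MeasurableSpace (Equiv.Perm (Fin k)) := ⊤

instance instDiscretePermFin (k : ℕ) : DiscreteMeasurableSpace (Equiv.Perm (Fin k)) :=
  ⟨fun _ => trivial⟩

/-- The subsets of `{1, …, p}` of cardinality `k`: the possible supports. -/
abbrev SupportSet (p k : ℕ) : Type := {s : Finset (Fin p) // s.card = k}

/-- The vector `β ∈ ℝ^p` that vanishes off `s` and whose restriction to `s`, listed in increasing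
order of the indices, is the permutation `(b_{π(1)}, …, b_{π(k)})` of `(b_1, …, b_k)`. -/
def dataVector {p k : ℕ} (b : Fin k → ℝ) (s : SupportSet p k) (π : Equiv.Perm (Fin k)) :
    Fin p → ℝ :=
  fun j => if h : j ∈ s.1 then b (π ((s.1.orderIsoOfFin s.2).symm ⟨j, h⟩)) else 0

/-- The sample space: the support, the permutation of the fixed vector, the `n × p` measurement
matrix (its rows are the measurement vectors), and the `n` noise variables. -/
abbrev Outcome (p k n : ℕ) : Type :=
  SupportSet p k × Equiv.Perm (Fin k) × (Fin n → Fin p → ℝ) × (Fin n → ℝ)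

/-- The joint law: the support is uniform on the subsets of size `k`, the permutation is uniform,
the entries of the matrix are i.i.d. `N(0, 1)`, the noise variables are i.i.d. `N(0, σ²)`, and
these four are independent. -/
def law (p k n : ℕ) (σ : ℝ) : Measure (Outcome p k n) :=
  (uniformOn (Set.univ : Set (SupportSet p k))).prod
    ((uniformOn (Set.univ : Set (Equiv.Perm (Fin k)))).prod
      ((Measure.pi fun _ : Fin n => Measure.pi fun _ : Fin p => gaussianReal 0 1).prod
        (Measure.pi fun _ : Fin n => gaussianReal 0 (Real.toNNReal (σ ^ 2)))))

/-- The support `S`. -/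
def support {p k n : ℕ} (ω : Outcome p k n) : Finset (Fin p) := ω.1.1

/-- The measurement matrix `X`. -/
def measurements {p k n : ℕ} (ω : Outcome p k n) : Fin n → Fin p → ℝ := ω.2.2.1

/-- The observation vector of the linear model, `Y⁽ⁱ⁾ = ⟨X⁽ⁱ⁾, β⟩ + Z⁽ⁱ⁾`. -/
def observations {p k n : ℕ} (b : Fin k → ℝ) (ω : Outcome p k n) : Fin n → ℝ :=
  fun i => (∑ j, ω.2.2.1 i j * dataVector b ω.1 ω.2.1 j) + ω.2.2.2 i

/-- A (deterministic, measurable) decoder, which forms an estimate of the support from the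
measurement matrix and the observations. -/
structure Decoder (p n : ℕ) where
  /-- The estimate of the support. -/
  estimate : (Fin n → Fin p → ℝ) × (Fin n → ℝ) → Finset (Fin p)
  /-- The estimate is a measurable function of the data. -/
  measurable_estimate : Measurable estimate

/-- The error probability `P_e = P[Ŝ ≠ S]` of a decoder. -/
def errorProb {p k n : ℕ} (σ : ℝ) (b : Fin k → ℝ) (d : Decoder p n) : ℝ :=
  (law p k n σ).real
    {ω | d.estimate (measurements ω, observations b ω) ≠ support ω}

/-- `b_min = min_i |b_i|`. -/
def bMin {k : ℕ} (b : Fin k → ℝ) : ℝ := ⨅ i, |b i|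

/-- `b_max = max_i |b_i|`. -/
def bMax {k : ℕ} (b : Fin k → ℝ) : ℝ := ⨆ i, |b i|

/-- The number `m_β` of distinct elements in `(b_1, …, b_k)`. -/
def numDistinct {k : ℕ} (b : Fin k → ℝ) : ℕ := (Set.range b).ncard

/-- The maximum over the nonempty `t ⊆ {1, …, k}` of
`log C(p - k, |t|) / ((1/2) log(1 + (1/σ²) ∑_{i ∈ t} b_i²))`
(the supremum of a finite family, nonempty if `k ≥ 1`). -/
def achThreshold (p : ℕ) {k : ℕ} (σ : ℝ) (b : Fin k → ℝ) : ℝ :=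
  ⨆ t : {t : Finset (Fin k) // t.Nonempty},
    Real.log ((p - k).choose t.1.card : ℝ) /
      ((1 / 2 : ℝ) * Real.log (1 + 1 / σ ^ 2 * ∑ i ∈ t.1, b i ^ 2))

/-- The maximum over the nonempty `t ⊆ {1, …, k}` of
`log C(p - k + |t|, |t|) / ((1/2) log(1 + (1/σ²) ∑_{i ∈ t} b_i²))`
(the supremum of a finite family, nonempty if `k ≥ 1`). -/
def convThreshold (p : ℕ) {k : ℕ} (σ : ℝ) (b : Fin k → ℝ) : ℝ :=
  ⨆ t : {t : Finset (Fin k) // t.Nonempty},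
    Real.log ((p - k + t.1.card).choose t.1.card : ℝ) /
      ((1 / 2 : ℝ) * Real.log (1 + 1 / σ ^ 2 * ∑ i ∈ t.1, b i ^ 2))

end SupportRecovery

end

/-!
For a set `t` of entries, let `v = ∑ i ∈ t, b i ^ 2` and let `I = (1/2) log (1 + v / σ²)`
(`information`). Both halves compare the observations under a data vector `a` with those in which
the component of `a` on the places of `t` is removed and replaced by noise of variance `v`. The
log-likelihood ratio of the two is the information density (`infoDensity`). Three facts about it
carry the proof:

* under the true vector its mean is `n I`, and its moment generating function is explicit, so that
  it deviates from `n I` by `δ n I` with probability at most `exp (-δ² n I / 8)`, a Chernoff bound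
  whose exponent is governed by `n I` alone, on both sides
  (`dataLaw_le_mul_infoDensity_sub_le`);
* if the entries in `t` are placed outside the true support, its exponential has mean one
  (`lintegral_exp_infoDensity`), so it exceeds `γ` with probability at most `exp (-γ)`;
* it allows a change of measure to the model in which the places of `t` do not matter
  (`dataLaw_infoDensity_le_le`).

*Converse.* Reveal the places of all entries outside the set `t` that attains the maximum. There
remain `M = C(p - k + |t|, |t|)` equally likely supports. The information density is at most
`(1 - η/2) log M` with high probability, since `n I ≤ (1 - η) log M`. On this event the probability
of success is at most `M ^ (1 - η/2)` times that in the model without information on the places of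
`t`, which is `1 / M` (`sum_dataLaw_eraseOn_le`, `one_sub_exp_le_errorProb`).

*Achievability.* The decoder accepts a support if, for some arrangement of the entries on it, the
information density of every nonempty `t` exceeds `(1 - δ) n I` (`PassesTest`). The true support is
rejected with probability at most `∑ t, exp (-δ² n I / 8)`. A support with `l` elements off the true
one is accepted with probability at most the number of arrangements times `exp (-(1 - δ) n I)`, and
there are `C(k, l) C(p - k, l)` of them. As `n I ≥ (1 + η) log C(p - k, l)`, both sums vanish as
soon as `log C(k, l)` and the logarithm of the number of arrangements are negligible with respect to
`n I` (`UnionBoundsNegligible`, `exists_tendsto_errorProb_zero`). That is checked for small supports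
with boundedly many distinct entries (which covers bounded supports), for polylogarithmic supports, and
for polynomial supports; in the last case, the number of measurements that the full support demands
is what makes small sets `t` harmless.
-/

namespace SupportRecovery

/-! ### Gaussian integrals and one measurement -/

section Gaussian

open Real

/-- The Gaussian integral of the exponential of a quadratic polynomial. -/
lemma lintegral_exp_quadratic_gaussianReal (a b : ℝ) (hb : b < 1 / 2) :
    ∫⁻ g, ENNReal.ofReal (exp (b * g ^ 2 + a * g)) ∂(gaussianReal 0 1) =
      ENNReal.ofReal ((√(1 - 2 * b))⁻¹ * exp (a ^ 2 / (2 * (1 - 2 * b)))) := by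
  have hD : 0 < 1 - 2 * b := by linarith
  set D := 1 - 2 * b with hDdef
  have hv : D⁻¹.toNNReal ≠ 0 := by simpa using hD
  have key : ∀ g : ℝ, gaussianPDFReal 0 1 g * exp (b * g ^ 2 + a * g) =
      ((√D)⁻¹ * exp (a ^ 2 / (2 * D))) *
        gaussianPDFReal (a / D) D⁻¹.toNNReal g := by
    intro g
    simp only [gaussianPDFReal, NNReal.coe_one, Real.coe_toNNReal _ (inv_pos.mpr hD).le, mul_one,
      sub_zero]
    have e1 : √(2 * π * D⁻¹) = √(2 * π) * (√D)⁻¹ := by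
      rw [Real.sqrt_mul (by positivity), Real.sqrt_inv]
    have e2 : (√D)⁻¹ * (√(2 * π) * (√D)⁻¹)⁻¹ = (√(2 * π))⁻¹ := by
      have : √D ≠ 0 := (Real.sqrt_pos.mpr hD).ne'
      have : √(2 * π) ≠ 0 := (Real.sqrt_pos.mpr (by positivity)).ne'
      field_simp
    rw [e1, mul_assoc, ← exp_add, mul_mul_mul_comm, e2, ← exp_add]
    congr 2
    field_simp
    rw [hDdef]
    ring
  rw [gaussianReal_of_var_ne_zero _ one_ne_zero,
    lintegral_withDensity_eq_lintegral_mul _ (measurable_gaussianPDF 0 1) (by fun_prop)]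
  have : ∀ g : ℝ, (gaussianPDF 0 1 * fun g => ENNReal.ofReal (exp (b * g ^ 2 + a * g))) g =
      ENNReal.ofReal ((√D)⁻¹ * exp (a ^ 2 / (2 * D))) *
        gaussianPDF (a / D) D⁻¹.toNNReal g := by
    intro g
    rw [Pi.mul_apply, gaussianPDF, gaussianPDF, ← ENNReal.ofReal_mul (gaussianPDFReal_nonneg _ _ _),
      key, ENNReal.ofReal_mul (by positivity)]
  simp_rw [this]
  rw [lintegral_const_mul _ (measurable_gaussianPDF _ _), lintegral_gaussianPDF_eq_one _ hv,
    mul_one]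

lemma gaussianReal_eq_map_sqrt_mul {v : ℝ} (hv : 0 ≤ v) :
    gaussianReal 0 v.toNNReal = (gaussianReal 0 1).map (fun g => √v * g) := by
  rw [gaussianReal_map_const_mul]
  congr 1
  · simp
  · ext
    simp [Real.sq_sqrt hv, Real.coe_toNNReal _ hv]

/-- The information gained from one measurement: the logarithm of the ratio of the Gaussian
densities with variances `s` and `s + v`, where `e` is the residual under the full hypothesis
and `r` the residual under the hypothesis in which a component of variance `v` is treated as
noise. -/
noncomputable def infoTerm (s v r e : ℝ) : ℝ :=
  1 / 2 * log (1 + v / s) + r ^ 2 / (2 * (s + v)) - e ^ 2 / (2 * s)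

@[fun_prop]
lemma measurable_infoTerm {α : Type*} [MeasurableSpace α] (s v : ℝ) {r e : α → ℝ}
    (hr : Measurable r) (he : Measurable e) : Measurable fun x => infoTerm s v (r x) (e x) := by
  unfold infoTerm
  fun_prop

/-- Averaging the density ratio over the unknown component gives one: the denominator is the
Gaussian mixture of the numerator. -/
lemma lintegral_exp_infoTerm {s v : ℝ} (hs : 0 < s) (hv : 0 ≤ v) (u : ℝ) :
    ∫⁻ w, ENNReal.ofReal (exp (infoTerm s v u (u - w))) ∂(gaussianReal 0 v.toNNReal) = 1 := by
  rw [gaussianReal_eq_map_sqrt_mul hv, lintegral_map (by fun_prop) (by fun_prop)]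
  have hsv : 0 < s + v := by linarith
  have h1 : ∀ g : ℝ, ENNReal.ofReal (exp (infoTerm s v u (u - √v * g))) =
      ENNReal.ofReal (exp (infoTerm s v u u)) *
        ENNReal.ofReal (exp (-(v / (2 * s)) * g ^ 2 + (u * √v / s) * g)) := by
    intro g
    rw [← ENNReal.ofReal_mul (exp_pos _).le, ← exp_add]
    congr 2
    unfold infoTerm
    have : (u - √v * g) ^ 2 = u ^ 2 - 2 * u * √v * g + v * g ^ 2 := by
      rw [sub_sq, mul_pow, Real.sq_sqrt hv]; ring
    rw [this]
    field_simp
    ring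
  simp_rw [h1]
  have hvs : 0 ≤ v / (2 * s) := by positivity
  rw [lintegral_const_mul _ (by fun_prop),
    lintegral_exp_quadratic_gaussianReal _ _ (by linarith),
    ← ENNReal.ofReal_mul (exp_pos _).le, ← ENNReal.ofReal_one]
  congr 1
  have e1 : 1 - 2 * -(v / (2 * s)) = 1 + v / s := by field_simp; ring
  have h2 : 0 < 1 + v / s := by positivity
  have h3 : (√(1 + v / s))⁻¹ = exp (-(1 / 2 * log (1 + v / s))) := by
    rw [Real.sqrt_eq_rpow, Real.rpow_def_of_pos h2, ← exp_neg]; ring_nf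
  rw [e1, h3, ← exp_add, ← exp_add, Real.exp_eq_one_iff]
  unfold infoTerm
  rw [div_pow, mul_pow, Real.sq_sqrt hv]
  field_simp
  ring

/-- The moment generating function of the centred information gain, under the full hypothesis.
The two-sided Gaussian tails of the information density rest on it. -/
lemma lintegral_exp_mul_infoTerm_le {s v l : ℝ} (hs : 0 < s) (hv : 0 ≤ v) (hl : |l| ≤ 1 / 2) :
    ∫⁻ w, ∫⁻ z, ENNReal.ofReal (exp (l * (infoTerm s v (w + z) z - 1 / 2 * log (1 + v / s))))
      ∂(gaussianReal 0 s.toNNReal) ∂(gaussianReal 0 v.toNNReal) ≤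
      ENNReal.ofReal (exp (l ^ 2 * log (1 + v / s))) := by
  have hsv : 0 < s + v := by linarith
  rw [gaussianReal_eq_map_sqrt_mul hv, gaussianReal_eq_map_sqrt_mul hs.le]
  rw [lintegral_map (Measurable.lintegral_prod_right' (f := fun q : ℝ × ℝ =>
    ENNReal.ofReal (exp (l * (infoTerm s v (q.1 + q.2) q.2 - 1 / 2 * log (1 + v / s)))))
      (by fun_prop)) (by fun_prop)]
  have hin : ∀ g : ℝ, ∫⁻ z, ENNReal.ofReal (exp (l * (infoTerm s v (√v * g + z) z -
        1 / 2 * log (1 + v / s)))) ∂((gaussianReal 0 1).map fun h => √s * h) =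
      ∫⁻ h, ENNReal.ofReal (exp (l * (infoTerm s v (√v * g + √s * h) (√s * h) -
        1 / 2 * log (1 + v / s)))) ∂(gaussianReal 0 1) :=
    fun g => lintegral_map (by fun_prop) (by fun_prop)
  simp_rw [hin]
  rw [lintegral_lintegral_swap (by fun_prop)]
  set q := v / (s + v) with hq
  have hq0 : 0 ≤ q := by positivity
  have hq1 : q < 1 := by rw [hq, div_lt_one hsv]; linarith
  have hl2 : l ^ 2 ≤ 1 / 4 := by
    have := abs_le.mp hl
    nlinarith
  have hlq : l * q ≤ 1 / 2 := by
    have := abs_le.mp hl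
    nlinarith
  have hlq2 : 0 < 1 - l * q := by linarith
  set r := √s * √v / (s + v) with hr
  have hr2 : r ^ 2 = q * (1 - q) := by
    rw [hr, div_pow, mul_pow, Real.sq_sqrt hs.le, Real.sq_sqrt hv, hq]
    field_simp
    ring
  have h1 : ∀ h g : ℝ, ENNReal.ofReal (exp (l * (infoTerm s v (√v * g + √s * h) (√s * h) -
        1 / 2 * log (1 + v / s)))) =
      ENNReal.ofReal (exp (-(l * q / 2) * h ^ 2)) *
        ENNReal.ofReal (exp (l * q / 2 * g ^ 2 + (l * r * h) * g)) := by
    intro h g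
    rw [← ENNReal.ofReal_mul (exp_pos _).le, ← exp_add]
    congr 2
    unfold infoTerm
    have : (√v * g + √s * h) ^ 2 = v * g ^ 2 + 2 * (√s * √v) * g * h + s * h ^ 2 := by
      rw [add_sq, mul_pow, mul_pow, Real.sq_sqrt hv, Real.sq_sqrt hs.le]; ring
    rw [this, mul_pow, Real.sq_sqrt hs.le, hq, hr]
    field_simp
    ring
  simp_rw [h1]
  have h2 : ∀ h : ℝ, ∫⁻ g, ENNReal.ofReal (exp (-(l * q / 2) * h ^ 2)) *
        ENNReal.ofReal (exp (l * q / 2 * g ^ 2 + (l * r * h) * g)) ∂(gaussianReal 0 1) =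
      ENNReal.ofReal ((√(1 - l * q))⁻¹) * ENNReal.ofReal
        (exp ((-(l * q / 2) + (l * r) ^ 2 / (2 * (1 - l * q))) * h ^ 2 + 0 * h)) := by
    intro h
    rw [lintegral_const_mul _ (by fun_prop),
      lintegral_exp_quadratic_gaussianReal _ _ (by linarith),
      ← ENNReal.ofReal_mul (exp_pos _).le, ← ENNReal.ofReal_mul (by positivity)]
    congr 1
    rw [mul_left_comm, ← exp_add]
    have : 1 - 2 * (l * q / 2) = 1 - l * q := by ring
    rw [this]
    congr 2
    field_simp
    ring
  simp_rw [h2]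
  have hx : 0 < 1 - l ^ 2 * q := by nlinarith
  have h4 : (1 - l * q) * (1 - 2 * (-(l * q / 2) + (l * r) ^ 2 / (2 * (1 - l * q)))) =
      1 - l ^ 2 * q := by
    rw [mul_pow, hr2]
    field_simp
    ring
  have h5 : 0 < 1 - 2 * (-(l * q / 2) + (l * r) ^ 2 / (2 * (1 - l * q))) := by
    by_contra! hc
    have := mul_nonpos_of_nonneg_of_nonpos hlq2.le hc
    linarith
  rw [lintegral_const_mul _ (by fun_prop),
    lintegral_exp_quadratic_gaussianReal _ _ (by linarith),
    ← ENNReal.ofReal_mul (by positivity)]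
  apply ENNReal.ofReal_le_ofReal
  rw [zero_pow two_ne_zero, zero_div, exp_zero, mul_one, ← mul_inv, ← Real.sqrt_mul hlq2.le, h4]
  -- `(1 - x)^(-1/2) ≤ exp x` for `x = l² q ≤ 1/2`, and `q ≤ log (1 + v / s)`
  have h6 : q ≤ log (1 + v / s) := by
    have := Real.one_sub_inv_le_log_of_pos (show 0 < 1 + v / s by positivity)
    refine le_trans (le_of_eq ?_) this
    rw [hq]
    field_simp
    ring
  have h7 : exp (-(l ^ 2 * q)) ≤ √(1 - l ^ 2 * q) := by
    apply Real.le_sqrt_of_sq_le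
    rw [← exp_nat_mul, Nat.cast_ofNat, mul_neg, exp_neg]
    apply inv_le_of_inv_le₀ hx
    refine le_trans ?_ (Real.add_one_le_exp _)
    rw [inv_le_iff_one_le_mul₀ hx]
    have h8 : 0 ≤ l ^ 2 * q := by positivity
    have h9 : l ^ 2 * q ≤ 1 / 4 := by nlinarith
    nlinarith
  calc (√(1 - l ^ 2 * q))⁻¹ ≤ (exp (-(l ^ 2 * q)))⁻¹ := inv_anti₀ (exp_pos _) h7
    _ = exp (l ^ 2 * q) := by rw [exp_neg, inv_inv]
    _ ≤ _ := by gcongr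

/-- Change of measure for one observation. -/
lemma gaussianReal_eq_withDensity {s v : ℝ} (hs : 0 < s) (hv : 0 ≤ v) (m₁ m₂ : ℝ) :
    gaussianReal m₁ s.toNNReal = (gaussianReal m₂ (s + v).toNNReal).withDensity
      fun y => ENNReal.ofReal (exp (infoTerm s v (y - m₂) (y - m₁))) := by
  have hsv : 0 < s + v := by linarith
  have h1 : s.toNNReal ≠ 0 := by simpa using hs
  have h2 : (s + v).toNNReal ≠ 0 := by simpa using hsv
  rw [gaussianReal_of_var_ne_zero _ h1, gaussianReal_of_var_ne_zero _ h2,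
    ← withDensity_mul _ (measurable_gaussianPDF _ _) (by fun_prop)]
  congr 1
  ext1 y
  rw [Pi.mul_apply, gaussianPDF, gaussianPDF, ← ENNReal.ofReal_mul (gaussianPDFReal_nonneg _ _ _)]
  congr 1
  simp only [gaussianPDFReal, Real.coe_toNNReal _ hs.le, Real.coe_toNNReal _ hsv.le]
  have h3 : exp (1 / 2 * log (1 + v / s)) = √(1 + v / s) := by
    rw [Real.sqrt_eq_rpow, Real.rpow_def_of_pos (by positivity), mul_comm]
  have h4 : (√(2 * π * s))⁻¹ = (√(2 * π * (s + v)))⁻¹ * √(1 + v / s) := by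
    have : 2 * π * (s + v) = 2 * π * s * (1 + v / s) := by field_simp
    rw [this, Real.sqrt_mul (by positivity) (1 + v / s)]
    have : √(1 + v / s) ≠ 0 := (Real.sqrt_pos.mpr (by positivity)).ne'
    have : √(2 * π * s) ≠ 0 := (Real.sqrt_pos.mpr (by positivity)).ne'
    field_simp
  rw [h4, ← h3, mul_assoc, mul_assoc _ (exp _) (exp _), ← exp_add, ← exp_add]
  congr 2
  unfold infoTerm
  field_simp
  ring

/-- The linear functionals of a standard Gaussian vector are Gaussian. -/
lemma map_sum_mul_pi_gaussianReal {ι : Type*} [Fintype ι] (a : ι → ℝ) :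
    (Measure.pi fun _ : ι => gaussianReal 0 1).map (fun x => ∑ i, x i * a i) =
      gaussianReal 0 (∑ i, a i ^ 2).toNNReal := by
  classical
  have hind : iIndepFun (fun (i : ι) (x : ι → ℝ) => x i * a i)
      (Measure.pi fun _ : ι => gaussianReal 0 1) :=
    iIndepFun_pi (X := fun i g => g * a i) fun i => by fun_prop
  have hmap : ∀ i, (Measure.pi fun _ : ι => gaussianReal 0 1).map (fun x => x i * a i) =
      gaussianReal 0 (a i ^ 2).toNNReal := by
    intro i
    have h1 : (Measure.pi fun _ : ι => gaussianReal 0 1).map (fun x => x i) = gaussianReal 0 1 :=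
      (measurePreserving_eval (fun _ : ι => gaussianReal 0 1) i).map_eq
    have h2 := Measure.map_map (μ := Measure.pi fun _ : ι => gaussianReal 0 1)
      (g := fun g : ℝ => g * a i) (f := fun x : ι → ℝ => x i) (by fun_prop) (by fun_prop)
    rw [h1, gaussianReal_map_mul_const] at h2
    rw [show (fun x : ι → ℝ => x i * a i) = (fun g : ℝ => g * a i) ∘ fun x : ι → ℝ => x i from rfl,
      ← h2]
    congr 1
    · simp
    · ext; simp [sq_nonneg]
  have key : ∀ t : Finset ι, (Measure.pi fun _ : ι => gaussianReal 0 1).map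
      (fun x => ∑ i ∈ t, x i * a i) = gaussianReal 0 (∑ i ∈ t, a i ^ 2).toNNReal := by
    intro t
    induction t using Finset.induction_on with
    | empty => simp
    | insert j t hj ih =>
      have hI : IndepFun (fun x : ι → ℝ => x j * a j) (fun x : ι → ℝ => ∑ i ∈ t, x i * a i)
          (Measure.pi fun _ : ι => gaussianReal 0 1) := by
        have := (hind.indepFun_finsetSum_of_notMem (fun i => by fun_prop) hj).symm
        convert this using 1
        ext x
        simp
      have := gaussianReal_add_gaussianReal_of_indepFun hI (hmap j) ih
      rw [← Real.toNNReal_add (sq_nonneg _) (Finset.sum_nonneg fun i _ => sq_nonneg _),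
        ← Finset.sum_insert (f := fun i => a i ^ 2) hj, add_zero] at this
      rw [← this]
      congr 1
      ext x
      simp [Finset.sum_insert hj]
  exact key Finset.univ

/-- Two linear functionals of a standard Gaussian vector with disjoint supports are independent. -/
lemma map_prod_sum_mul_pi_gaussianReal {ι : Type*} [Fintype ι] (c a : ι → ℝ)
    (hca : ∀ i, c i = 0 ∨ a i = 0) :
    (Measure.pi fun _ : ι => gaussianReal 0 1).map
        (fun x => (∑ i, x i * c i, ∑ i, x i * a i)) =
      ((Measure.pi fun _ : ι => gaussianReal 0 1).map (fun x => ∑ i, x i * c i)).prod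
        (gaussianReal 0 (∑ i, a i ^ 2).toNNReal) := by
  classical
  have hind : iIndepFun (fun (i : ι) (x : ι → ℝ) => x i)
      (Measure.pi fun _ : ι => gaussianReal 0 1) :=
    iIndepFun_pi (X := fun i g => g) fun i => by fun_prop
  set S : Finset ι := Finset.univ.filter fun i => a i = 0
  have h1 := hind.indepFun_finset S Sᶜ disjoint_compl_right (fun i => by fun_prop)
  have h2 := h1.comp (φ := fun y => ∑ i : S, y i * c i)
    (ψ := fun y => ∑ i : (Sᶜ : Finset ι), y i * a i)
    (by fun_prop) (by fun_prop)
  rw [← map_sum_mul_pi_gaussianReal a]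
  have hI : IndepFun (fun x : ι → ℝ => ∑ i, x i * c i) (fun x : ι → ℝ => ∑ i, x i * a i)
      (Measure.pi fun _ : ι => gaussianReal 0 1) := by
    convert h2 using 1
    · ext x
      simp only [Function.comp]
      rw [Finset.sum_coe_sort S (fun i => x i * c i)]
      refine (Finset.sum_subset (Finset.subset_univ _) fun i _ hi => ?_).symm
      have : a i ≠ 0 := by simpa [S] using hi
      rcases hca i with h | h
      · simp [h]
      · exact absurd h this
    · ext x
      simp only [Function.comp]
      rw [Finset.sum_coe_sort Sᶜ (fun i => x i * a i)]
      refine (Finset.sum_subset (Finset.subset_univ _) fun i _ hi => ?_).symm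
      have : a i = 0 := by simpa [S] using hi
      simp [this]
  exact (indepFun_iff_map_prod_eq_prod_map_map (by fun_prop : Measurable _).aemeasurable
    (by fun_prop : Measurable _).aemeasurable).1 hI

end Gaussian

open Real (exp log)

/-! ### The information density of a block of measurements -/

/-- The law of the measurement matrix together with an independent noise vector of variance `s`. -/
noncomputable def dataLaw (n p : ℕ) (s : ℝ) : Measure ((Fin n → Fin p → ℝ) × (Fin n → ℝ)) :=
  (Measure.pi fun _ : Fin n => Measure.pi fun _ : Fin p => gaussianReal 0 1).prod
    (Measure.pi fun _ : Fin n => gaussianReal 0 s.toNNReal)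

instance isProbabilityMeasure_dataLaw (n p : ℕ) (s : ℝ) : IsProbabilityMeasure (dataLaw n p s) := by
  unfold dataLaw
  infer_instance

/-- The observations `x β + z` of the vector `β` in the noise `z`. -/
def linearObservations {n p : ℕ} (β : Fin p → ℝ) (q : (Fin n → Fin p → ℝ) × (Fin n → ℝ)) :
    Fin n → ℝ :=
  fun i => (∑ j, q.1 i j * β j) + q.2 i

@[fun_prop]
lemma measurable_linearObservations {n p : ℕ} (β : Fin p → ℝ) :
    Measurable (linearObservations (n := n) β) := by
  unfold linearObservations
  fun_prop

/-- The information density of the vector `a` given its known part `c`, the unknown part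
having variance `v` in each measurement: the log-likelihood ratio of the observations `y` between
the noisy linear model with vector `a`, and the one with vector `c` and noise of
variance `s + v`. -/
noncomputable def infoDensity {n p : ℕ} (s v : ℝ) (c a : Fin p → ℝ)
    (q : (Fin n → Fin p → ℝ) × (Fin n → ℝ)) : ℝ :=
  ∑ i, infoTerm s v (q.2 i - ∑ j, q.1 i j * c j) (q.2 i - ∑ j, q.1 i j * a j)

@[fun_prop]
lemma measurable_infoDensity {n p : ℕ} (s v : ℝ) (c a : Fin p → ℝ) :
    Measurable (infoDensity (n := n) s v c a) := by
  unfold infoDensity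
  fun_prop

/-- A random variable that is a product over the measurements has a power for its expectation. -/
lemma lintegral_prod_dataLaw {n p : ℕ} (s : ℝ) {F : (Fin p → ℝ) × ℝ → ENNReal}
    (hF : Measurable F) :
    ∫⁻ q, ∏ i, F (q.1 i, q.2 i) ∂(dataLaw n p s) =
      (∫⁻ x, ∫⁻ z, F (x, z) ∂(gaussianReal 0 s.toNNReal)
        ∂(Measure.pi fun _ : Fin p => gaussianReal 0 1)) ^ n := by
  unfold dataLaw
  rw [lintegral_prod _ (by fun_prop)]
  have hpi : ∀ {Ω : Type} [MeasurableSpace Ω] (μ : Measure Ω) [IsProbabilityMeasure μ]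
      (f : Fin n → Ω → ENNReal), (∀ i, Measurable (f i)) →
      ∫⁻ ω, ∏ i, f i (ω i) ∂(Measure.pi fun _ : Fin n => μ) = ∏ i, ∫⁻ ω, f i ω ∂μ := by
    intro Ω _ μ _ f hf
    have h1 := lintegral_prod_eq_prod_lintegral_of_indepFun Finset.univ
      (fun (i : Fin n) (ω : Fin n → Ω) => f i (ω i))
      (iIndepFun_pi (μ := fun _ : Fin n => μ) (X := f) fun i => (hf i).aemeasurable)
      (fun i => (hf i).comp (measurable_pi_apply i))
    rw [h1]
    exact Finset.prod_congr rfl fun i _ =>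
      (measurePreserving_eval (fun _ : Fin n => μ) i).lintegral_comp (hf i)
  have h2 : ∀ x : Fin n → Fin p → ℝ,
      ∫⁻ z, ∏ i, F (x i, z i) ∂(Measure.pi fun _ : Fin n => gaussianReal 0 s.toNNReal) =
        ∏ i, ∫⁻ z, F (x i, z) ∂(gaussianReal 0 s.toNNReal) :=
    fun x => hpi _ (fun i z => F (x i, z)) fun i => by fun_prop
  simp_rw [h2]
  rw [hpi _ (fun _ x => ∫⁻ z, F (x, z) ∂(gaussianReal 0 s.toNNReal))
    fun _ => hF.lintegral_prod_right']
  simp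

/-- The exponential of the information density is a product over the measurements. It is stated
with the factor `l` and the centring `t` that the moment generating function needs. -/
lemma exp_infoDensity_linearObservations {n p : ℕ} (s v l t : ℝ) (c a β : Fin p → ℝ)
    (q : (Fin n → Fin p → ℝ) × (Fin n → ℝ)) :
    ENNReal.ofReal (exp (l * (infoDensity s v c a (q.1, linearObservations β q) - n * t))) =
      ∏ i, ENNReal.ofReal (exp (l * (infoTerm s v (∑ j, q.1 i j * (β j - c j) + q.2 i)
        (∑ j, q.1 i j * (β j - a j) + q.2 i) - t))) := by
  rw [← ENNReal.ofReal_prod_of_nonneg fun i _ => (Real.exp_pos _).le, ← Real.exp_sum,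
    ← Finset.mul_sum, Finset.sum_sub_distrib]
  simp only [infoDensity, linearObservations, mul_sub, Finset.sum_sub_distrib, Finset.sum_const,
    Finset.card_univ, Fintype.card_fin, nsmul_eq_mul]
  congr 6
  ext i
  congr 1 <;> ring

/-- If the component of `a` outside the known part `c` is disjoint from the component of the true
vector `β` outside `c`, the information density of `a` is the logarithm of a variable of mean one,
so that it is seldom large. -/
lemma lintegral_exp_infoDensity {n p : ℕ} {s : ℝ} (hs : 0 < s) {c a β : Fin p → ℝ}
    (h : ∀ j, β j - c j = 0 ∨ a j - c j = 0) :
    ∫⁻ q, ENNReal.ofReal (exp (infoDensity s (∑ j, (a j - c j) ^ 2) c a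
      (q.1, linearObservations β q))) ∂(dataLaw n p s) = 1 := by
  set v := ∑ j, (a j - c j) ^ 2 with hv
  have hv0 : 0 ≤ v := Finset.sum_nonneg fun j _ => sq_nonneg _
  have h1 := exp_infoDensity_linearObservations (n := n) s v 1 0 c a β
  simp only [one_mul, mul_zero, sub_zero] at h1
  simp_rw [h1]
  rw [lintegral_prod_dataLaw s (F := fun q => ENNReal.ofReal (exp (infoTerm s v
    (∑ j, q.1 j * (β j - c j) + q.2) (∑ j, q.1 j * (β j - a j) + q.2)))) (by fun_prop),
    lintegral_lintegral_swap (by fun_prop)]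
  have h2 : ∀ z : ℝ, ∫⁻ x, ENNReal.ofReal (exp (infoTerm s v
      (∑ j, x j * (β j - c j) + z) (∑ j, x j * (β j - a j) + z)))
        ∂(Measure.pi fun _ : Fin p => gaussianReal 0 1) = 1 := by
    intro z
    have h3 : ∀ x : Fin p → ℝ, ENNReal.ofReal (exp (infoTerm s v
        (∑ j, x j * (β j - c j) + z) (∑ j, x j * (β j - a j) + z))) =
        (fun u : ℝ × ℝ => ENNReal.ofReal (exp (infoTerm s v (u.1 + z) (u.1 + z - u.2))))
          (∑ j, x j * (β j - c j), ∑ j, x j * (a j - c j)) := by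
      intro x
      simp only [mul_sub, Finset.sum_sub_distrib]
      congr 3
      ring
    simp_rw [h3]
    rw [← lintegral_map (μ := Measure.pi fun _ : Fin p => gaussianReal 0 1)
      (f := fun u : ℝ × ℝ => ENNReal.ofReal (exp (infoTerm s v (u.1 + z) (u.1 + z - u.2))))
      (g := fun x => (∑ j, x j * (β j - c j), ∑ j, x j * (a j - c j)))
      (by fun_prop) (by fun_prop), map_prod_sum_mul_pi_gaussianReal _ _ h,
      lintegral_prod _ (by fun_prop)]
    simp_rw [← hv, lintegral_exp_infoTerm hs hv0]
    have : IsProbabilityMeasure ((Measure.pi fun _ : Fin p => gaussianReal 0 1).map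
        fun x => ∑ j, x j * (β j - c j)) :=
      Measure.isProbabilityMeasure_map (by fun_prop : Measurable _).aemeasurable
    simp
  simp_rw [h2]
  simp

lemma dataLaw_lt_infoDensity_le {n p : ℕ} {s : ℝ} (hs : 0 < s) {c a β : Fin p → ℝ}
    (h : ∀ j, β j - c j = 0 ∨ a j - c j = 0) (γ : ℝ) :
    dataLaw n p s {q | γ < infoDensity s (∑ j, (a j - c j) ^ 2) c a
      (q.1, linearObservations β q)} ≤ ENNReal.ofReal (exp (-γ)) := by
  have h1 := mul_meas_ge_le_lintegral (μ := dataLaw n p s)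
    (f := fun q => ENNReal.ofReal (exp (infoDensity s (∑ j, (a j - c j) ^ 2) c a
      (q.1, linearObservations β q)))) (by fun_prop) (ENNReal.ofReal (exp γ))
  rw [lintegral_exp_infoDensity hs h, mul_comm] at h1
  rw [Real.exp_neg, ENNReal.ofReal_inv_of_pos (Real.exp_pos _)]
  refine le_trans (measure_mono fun q hq => ?_)
    (ENNReal.le_inv_iff_mul_le.mpr h1)
  exact ENNReal.ofReal_le_ofReal (Real.exp_le_exp.mpr (le_of_lt hq))

/-- The tails of the information density of the true vector: a Chernoff bound, for the upper tail
if `l > 0` and for the lower tail if `l < 0`. -/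
lemma dataLaw_le_mul_infoDensity_sub_le {n p : ℕ} {s : ℝ} (hs : 0 < s) (c β : Fin p → ℝ) {l : ℝ}
    (hl : |l| ≤ 1 / 2) (t : ℝ) :
    dataLaw n p s {q | t ≤ l * (infoDensity s (∑ j, (β j - c j) ^ 2) c β
        (q.1, linearObservations β q) -
          n * (1 / 2 * log (1 + (∑ j, (β j - c j) ^ 2) / s)))} ≤
      ENNReal.ofReal
        (exp (2 * l ^ 2 * (n * (1 / 2 * log (1 + (∑ j, (β j - c j) ^ 2) / s))) - t)) := by
  set v := ∑ j, (β j - c j) ^ 2 with hv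
  have hv0 : 0 ≤ v := Finset.sum_nonneg fun j _ => sq_nonneg _
  have h1 := mul_meas_ge_le_lintegral (μ := dataLaw n p s)
    (f := fun q => ENNReal.ofReal (exp (l * (infoDensity s v c β
      (q.1, linearObservations β q) - n * (1 / 2 * log (1 + v / s)))))) (by fun_prop)
    (ENNReal.ofReal (exp t))
  have h2 : ∫⁻ q, ENNReal.ofReal (exp (l * (infoDensity s v c β
      (q.1, linearObservations β q) - n * (1 / 2 * log (1 + v / s))))) ∂(dataLaw n p s) ≤
        ENNReal.ofReal (exp (2 * l ^ 2 * (n * (1 / 2 * log (1 + v / s))))) := by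
    simp_rw [exp_infoDensity_linearObservations]
    rw [lintegral_prod_dataLaw s (F := fun q => ENNReal.ofReal (exp (l * (infoTerm s v
      (∑ j, q.1 j * (β j - c j) + q.2) (∑ j, q.1 j * (β j - β j) + q.2) -
        1 / 2 * log (1 + v / s))))) (by fun_prop)]
    simp only [sub_self, mul_zero, Finset.sum_const_zero, zero_add]
    rw [← lintegral_map (μ := Measure.pi fun _ : Fin p => gaussianReal 0 1)
      (f := fun w : ℝ => ∫⁻ z, ENNReal.ofReal (exp (l * (infoTerm s v (w + z) z -
        1 / 2 * log (1 + v / s)))) ∂(gaussianReal 0 s.toNNReal))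
      (g := fun x => ∑ j, x j * (β j - c j))
      (Measurable.lintegral_prod_right' (f := fun q : ℝ × ℝ =>
        ENNReal.ofReal (exp (l * (infoTerm s v (q.1 + q.2) q.2 - 1 / 2 * log (1 + v / s)))))
          (by fun_prop)) (by fun_prop), map_sum_mul_pi_gaussianReal, ← hv]
    refine (pow_le_pow_left₀ (zero_le) (lintegral_exp_mul_infoTerm_le hs hv0 hl) n).trans_eq ?_
    rw [← ENNReal.ofReal_pow (Real.exp_pos _).le, ← Real.exp_nat_mul]
    congr 2
    ring
  rw [Real.exp_sub, ENNReal.ofReal_div_of_pos (Real.exp_pos _)]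
  rw [ENNReal.le_div_iff_mul_le (Or.inl (by simp [Real.exp_pos]))
    (Or.inl ENNReal.ofReal_ne_top), mul_comm]
  refine le_trans ?_ (h1.trans h2)
  gcongr with q
  intro hq
  exact ENNReal.ofReal_le_ofReal (Real.exp_le_exp.mpr hq)

/-- Product measures of densities have the product of the densities as their density. -/
lemma pi_withDensity {n : ℕ} {μ : Fin n → Measure ℝ} [∀ i, IsProbabilityMeasure (μ i)]
    {f : Fin n → ℝ → ENNReal} (hf : ∀ i, Measurable (f i))
    [∀ i, IsProbabilityMeasure ((μ i).withDensity (f i))] :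
    (Measure.pi fun i => (μ i).withDensity (f i)) =
      (Measure.pi μ).withDensity fun x => ∏ i, f i (x i) := by
  refine (Measure.pi_eq fun t ht => ?_)
  rw [withDensity_apply _ (MeasurableSet.univ_pi ht),
    ← lintegral_indicator (MeasurableSet.univ_pi ht)]
  have h1 : ∀ x : Fin n → ℝ, (Set.univ.pi t).indicator (fun x => ∏ i, f i (x i)) x =
      ∏ i, (t i).indicator (f i) (x i) := by
    intro x
    by_cases hx : x ∈ Set.univ.pi t
    · rw [Set.indicator_of_mem hx]
      exact Finset.prod_congr rfl fun i _ => (Set.indicator_of_mem (hx i (Set.mem_univ i)) _).symm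
    · rw [Set.indicator_of_notMem hx]
      simp only [Set.mem_univ_pi, not_forall] at hx
      obtain ⟨i, hi⟩ := hx
      exact (Finset.prod_eq_zero (Finset.mem_univ i) (Set.indicator_of_notMem hi _)).symm
  simp_rw [h1]
  have h2 := lintegral_prod_eq_prod_lintegral_of_indepFun (μ := Measure.pi μ) Finset.univ
    (fun (i : Fin n) (x : Fin n → ℝ) => (t i).indicator (f i) (x i))
    (iIndepFun_pi (X := fun i => (t i).indicator (f i))
      fun i => ((hf i).indicator (ht i)).aemeasurable)
    (fun i => ((hf i).indicator (ht i)).comp (measurable_pi_apply i))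
  rw [h2]
  refine Finset.prod_congr rfl fun i _ => ?_
  rw [(measurePreserving_eval μ i).lintegral_comp ((hf i).indicator (ht i)),
    lintegral_indicator (ht i), withDensity_apply _ (ht i)]

lemma map_const_add_pi_gaussianReal {n : ℕ} (m : Fin n → ℝ) (s : ℝ) :
    (Measure.pi fun _ : Fin n => gaussianReal 0 s.toNNReal).map (fun z i => m i + z i) =
      Measure.pi fun i => gaussianReal (m i) s.toNNReal := by
  rw [Measure.pi_map_pi (f := fun i z => m i + z) fun i => by fun_prop]
  simp_rw [gaussianReal_map_const_add, zero_add]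

/-- Change of measure from the model with vector `a` to the one with vector `c` and a larger
noise: where the information density is at most `γ`, the cost is a factor `exp γ`. -/
lemma dataLaw_infoDensity_le_le {n p : ℕ} {s v : ℝ} (hs : 0 < s) (hv : 0 ≤ v) (c a : Fin p → ℝ)
    (γ : ℝ) {D : Set ((Fin n → Fin p → ℝ) × (Fin n → ℝ))} (hD : MeasurableSet D) :
    dataLaw n p s {q | (q.1, linearObservations a q) ∈ D ∧
        infoDensity s v c a (q.1, linearObservations a q) ≤ γ} ≤
      ENNReal.ofReal (exp γ) *
        dataLaw n p (s + v) {q | (q.1, linearObservations c q) ∈ D} := by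
  have hg : ∀ β : Fin p → ℝ, Measurable fun q : (Fin n → Fin p → ℝ) × (Fin n → ℝ) =>
      (q.1, linearObservations β q) := fun β => by fun_prop
  have hE : MeasurableSet (D ∩ {q | infoDensity (n := n) s v c a q ≤ γ}) :=
    hD.inter (measurableSet_le (by fun_prop) (by fun_prop))
  have e1 : {q : (Fin n → Fin p → ℝ) × (Fin n → ℝ) | (q.1, linearObservations a q) ∈ D ∧
      infoDensity s v c a (q.1, linearObservations a q) ≤ γ} =
      (fun q => (q.1, linearObservations a q)) ⁻¹'
        (D ∩ {q | infoDensity (n := n) s v c a q ≤ γ}) := rfl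
  have e2 : {q : (Fin n → Fin p → ℝ) × (Fin n → ℝ) | (q.1, linearObservations c q) ∈ D} =
      (fun q => (q.1, linearObservations c q)) ⁻¹' D := rfl
  rw [e1, e2]
  unfold dataLaw
  rw [Measure.prod_apply (hg a hE), Measure.prod_apply (hg c hD),
    ← lintegral_const_mul _ (measurable_measure_prodMk_left (hg c hD))]
  refine lintegral_mono fun x => ?_
  set m₁ : Fin n → ℝ := fun i => ∑ j, x i j * a j
  set m₂ : Fin n → ℝ := fun i => ∑ j, x i j * c j
  have hx : Measurable fun y : Fin n → ℝ => (x, y) := by fun_prop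
  have e3 : (Prod.mk x ⁻¹' ((fun q : (Fin n → Fin p → ℝ) × (Fin n → ℝ) =>
      (q.1, linearObservations a q)) ⁻¹' (D ∩ {q | infoDensity (n := n) s v c a q ≤ γ}))) =
      (fun z i => m₁ i + z i) ⁻¹'
        (Prod.mk x ⁻¹' (D ∩ {q | infoDensity (n := n) s v c a q ≤ γ})) := rfl
  have e4 : (Prod.mk x ⁻¹' ((fun q : (Fin n → Fin p → ℝ) × (Fin n → ℝ) =>
      (q.1, linearObservations c q)) ⁻¹' D)) =
      (fun z i => m₂ i + z i) ⁻¹' (Prod.mk x ⁻¹' D) := rfl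
  rw [e3, e4, ← Measure.map_apply (by fun_prop) (hx hE), ← Measure.map_apply (by fun_prop) (hx hD),
    map_const_add_pi_gaussianReal, map_const_add_pi_gaussianReal]
  have hw : ∀ i, gaussianReal (m₁ i) s.toNNReal =
      (gaussianReal (m₂ i) (s + v).toNNReal).withDensity
        fun y => ENNReal.ofReal (exp (infoTerm s v (y - m₂ i) (y - m₁ i))) :=
    fun i => gaussianReal_eq_withDensity hs hv _ _
  have : ∀ i, IsProbabilityMeasure ((gaussianReal (m₂ i) (s + v).toNNReal).withDensity
        fun y => ENNReal.ofReal (exp (infoTerm s v (y - m₂ i) (y - m₁ i)))) := by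
    intro i
    rw [← hw]
    infer_instance
  simp_rw [hw]
  rw [pi_withDensity fun i => by fun_prop, withDensity_apply _ (hx hE)]
  calc _ ≤ ∫⁻ _ in Prod.mk x ⁻¹' (D ∩ {q | infoDensity (n := n) s v c a q ≤ γ}),
        ENNReal.ofReal (exp γ) ∂(Measure.pi fun i => gaussianReal (m₂ i) (s + v).toNNReal) := by
        refine setLIntegral_mono measurable_const fun y hy => ?_
        rw [← ENNReal.ofReal_prod_of_nonneg fun i _ => (Real.exp_pos _).le, ← Real.exp_sum]
        exact ENNReal.ofReal_le_ofReal (Real.exp_le_exp.mpr hy.2)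
    _ ≤ _ := by
        rw [setLIntegral_const]
        gcongr
        exact Set.inter_subset_left

/-! ### The joint law as an average over supports and arrangements -/

/-- The law of the model is the average of `dataLaw` over the supports and the permutations. -/
lemma law_apply {p k n : ℕ} (hkp : k ≤ p) (σ : ℝ) {A : Set (Outcome p k n)}
    (hA : MeasurableSet A) :
    law p k n σ A = (∑ s : SupportSet p k, ∑ π : Equiv.Perm (Fin k),
      dataLaw n p (σ ^ 2) {q | (s, π, q) ∈ A}) / (p.descFactorial k : ENNReal) := by
  have hu : ∀ {Ω : Type} [Fintype Ω] [MeasurableSpace Ω] [MeasurableSingletonClass Ω]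
      (f : Ω → ENNReal), ∫⁻ ω, f ω ∂(uniformOn (Set.univ : Set Ω)) =
        (∑ ω, f ω) / (Fintype.card Ω : ENNReal) := by
    intro Ω _ _ _ f
    rw [lintegral_fintype, div_eq_mul_inv, Finset.sum_mul]
    refine Finset.sum_congr rfl fun ω _ => ?_
    rw [uniformOn_univ, Measure.count_singleton, one_div]
  have hcard : Fintype.card (SupportSet p k) = p.choose k := by
    rw [Fintype.card_finset_len, Fintype.card_fin]
  have hne : Nonempty (SupportSet p k) := by
    rw [← Fintype.card_pos_iff, hcard]
    exact Nat.choose_pos hkp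
  unfold law
  rw [Measure.prod_apply hA, hu, hcard]
  have h1 : ∀ s : SupportSet p k, ((uniformOn (Set.univ : Set (Equiv.Perm (Fin k)))).prod
      ((Measure.pi fun _ : Fin n => Measure.pi fun _ : Fin p => gaussianReal 0 1).prod
        (Measure.pi fun _ : Fin n => gaussianReal 0 (Real.toNNReal (σ ^ 2))))) (Prod.mk s ⁻¹' A) =
      (∑ π : Equiv.Perm (Fin k), dataLaw n p (σ ^ 2) {q | (s, π, q) ∈ A}) /
        (k.factorial : ENNReal) := by
    intro s
    rw [Measure.prod_apply (measurable_prodMk_left hA), hu, Fintype.card_perm, Fintype.card_fin]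
    rfl
  simp_rw [h1]
  simp only [div_eq_mul_inv]
  rw [← Finset.sum_mul, mul_assoc, ← ENNReal.mul_inv (Or.inr (by simp))
    (Or.inl (by simp)), Nat.descFactorial_eq_factorial_mul_choose]
  push_cast
  rfl

lemma card_supportSet_mul_card_perm (p k : ℕ) :
    Fintype.card (SupportSet p k) * Fintype.card (Equiv.Perm (Fin k)) = p.descFactorial k := by
  rw [Fintype.card_finset_len, Fintype.card_fin, Fintype.card_perm, Fintype.card_fin, mul_comm,
    Nat.descFactorial_eq_factorial_mul_choose]

lemma measurable_observations {p k n : ℕ} (b : Fin k → ℝ) :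
    Measurable (fun ω : Outcome p k n => observations b ω) := by
  have hg : ∀ {α β γ : Type} [MeasurableSpace α] [Countable α] [MeasurableSingletonClass α]
      [MeasurableSpace β] [MeasurableSpace γ] (g : α → β → γ), (∀ a, Measurable (g a)) →
      Measurable fun r : α × β => g r.1 r.2 :=
    fun g hg => measurable_from_prod_countable_right hg
  have h := hg (fun (τ : SupportSet p k × Equiv.Perm (Fin k))
    (q : (Fin n → Fin p → ℝ) × (Fin n → ℝ)) => linearObservations (dataVector b τ.1 τ.2) q)
    fun τ => measurable_linearObservations _
  have h2 : Measurable fun ω : Outcome p k n => ((ω.1, ω.2.1), ω.2.2) := by fun_prop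
  exact h.comp h2

lemma measurableSet_estimate_eq_support {p k n : ℕ} (b : Fin k → ℝ) (d : Decoder p n) :
    MeasurableSet {ω : Outcome p k n |
      d.estimate (measurements ω, observations b ω) = support ω} := by
  have h1 : Measurable fun ω : Outcome p k n => d.estimate (measurements ω, observations b ω) :=
    d.measurable_estimate.comp (Measurable.prodMk (by unfold measurements; fun_prop)
      (measurable_observations b))
  have h2 : Measurable fun ω : Outcome p k n => support ω := by
    unfold support
    fun_prop
  exact measurableSet_eq_fun h1 h2

instance isProbabilityMeasure_law {p k n : ℕ} [hkp : Fact (k ≤ p)] (σ : ℝ) :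
    IsProbabilityMeasure (law p k n σ) := by
  have hne : Nonempty (SupportSet p k) := by
    rw [← Fintype.card_pos_iff, Fintype.card_finset_len, Fintype.card_fin]
    exact Nat.choose_pos hkp.out
  unfold law
  infer_instance

/-- An upper bound on the error probability, from a bound that is uniform in the support and
the permutation. -/
lemma errorProb_le {p k n : ℕ} (hkp : k ≤ p) {σ : ℝ} {b : Fin k → ℝ} {d : Decoder p n} {ε : ℝ}
    (hε : 0 ≤ ε)
    (h : ∀ (s : SupportSet p k) (π : Equiv.Perm (Fin k)), dataLaw n p (σ ^ 2)
      {q | d.estimate (q.1, linearObservations (dataVector b s π) q) ≠ s.1} ≤ ENNReal.ofReal ε) :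
    errorProb σ b d ≤ ε := by
  unfold errorProb
  rw [measureReal_def]
  refine ENNReal.toReal_le_of_le_ofReal hε ?_
  have hc : MeasurableSet {ω : Outcome p k n |
      d.estimate (measurements ω, observations b ω) ≠ support ω} :=
    (measurableSet_estimate_eq_support b d).compl
  rw [law_apply hkp σ hc]
  refine ENNReal.div_le_of_le_mul ?_
  calc _ ≤ ∑ s : SupportSet p k, ∑ π : Equiv.Perm (Fin k), ENNReal.ofReal ε :=
        Finset.sum_le_sum fun s _ => Finset.sum_le_sum fun π _ => h s π
    _ = _ := by
        rw [Finset.sum_const, Finset.sum_const, nsmul_eq_mul, nsmul_eq_mul, Finset.card_univ,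
          Finset.card_univ, ← mul_assoc, ← Nat.cast_mul, card_supportSet_mul_card_perm, mul_comm]

/-- A lower bound on the error probability, from a bound on the sum over the supports and the
permutations of the probabilities of success. -/
lemma one_sub_le_errorProb {p k n : ℕ} (hkp : k ≤ p) {σ : ℝ} {b : Fin k → ℝ} {d : Decoder p n}
    {ε : ℝ} (hε : 0 ≤ ε)
    (h : ∑ s : SupportSet p k, ∑ π : Equiv.Perm (Fin k), dataLaw n p (σ ^ 2)
      {q | d.estimate (q.1, linearObservations (dataVector b s π) q) = s.1} ≤
        ENNReal.ofReal ε * p.descFactorial k) :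
    1 - ε ≤ errorProb σ b d := by
  have : Fact (k ≤ p) := ⟨hkp⟩
  unfold errorProb
  have h1 := probReal_compl_eq_one_sub (μ := law p k n σ) (measurableSet_estimate_eq_support b d)
  have h2 : (law p k n σ).real
      {ω | d.estimate (measurements ω, observations b ω) = support ω} ≤ ε := by
    rw [measureReal_def]
    refine ENNReal.toReal_le_of_le_ofReal hε ?_
    rw [law_apply hkp σ (measurableSet_estimate_eq_support b d)]
    exact ENNReal.div_le_of_le_mul h
  have h3 : {ω : Outcome p k n | d.estimate (measurements ω, observations b ω) ≠ support ω} =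
      {ω | d.estimate (measurements ω, observations b ω) = support ω}ᶜ := rfl
  rw [h3, h1]
  linarith

lemma errorProb_nonneg {p k n : ℕ} (σ : ℝ) (b : Fin k → ℝ) (d : Decoder p n) :
    0 ≤ errorProb σ b d := measureReal_nonneg

lemma errorProb_le_one {p k n : ℕ} (hkp : k ≤ p) (σ : ℝ) (b : Fin k → ℝ) (d : Decoder p n) :
    errorProb σ b d ≤ 1 := by
  have : Fact (k ≤ p) := ⟨hkp⟩
  exact measureReal_le_one

/-- The coordinate `placement s π i` carries the entry `b i` of the data vector of `s` and `π`. -/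
noncomputable def placement {p k : ℕ} (s : SupportSet p k) (π : Equiv.Perm (Fin k)) :
    Fin k ↪ Fin p :=
  (π.symm.toEmbedding.trans (s.1.orderIsoOfFin s.2).toEquiv.toEmbedding).trans
    (Function.Embedding.subtype _)

lemma placement_apply {p k : ℕ} (s : SupportSet p k) (π : Equiv.Perm (Fin k)) (i : Fin k) :
    placement s π i = (s.1.orderIsoOfFin s.2 (π.symm i) : Fin p) := rfl

lemma placement_mem {p k : ℕ} (s : SupportSet p k) (π : Equiv.Perm (Fin k)) (i : Fin k) :
    placement s π i ∈ s.1 := (s.1.orderIsoOfFin s.2 (π.symm i)).2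

lemma dataVector_placement {p k : ℕ} (b : Fin k → ℝ) (s : SupportSet p k)
    (π : Equiv.Perm (Fin k)) (i : Fin k) : dataVector b s π (placement s π i) = b i := by
  unfold dataVector
  rw [dif_pos (placement_mem s π i)]
  have : (⟨placement s π i, placement_mem s π i⟩ : s.1) = s.1.orderIsoOfFin s.2 (π.symm i) := rfl
  rw [this, OrderIso.symm_apply_apply, Equiv.apply_symm_apply]

lemma map_placement {p k : ℕ} (s : SupportSet p k) (π : Equiv.Perm (Fin k)) :
    Finset.univ.map (placement s π) = s.1 := by
  apply Finset.eq_of_subset_of_card_le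
  · intro j hj
    obtain ⟨i, -, rfl⟩ := Finset.mem_map.1 hj
    exact placement_mem s π i
  · rw [Finset.card_map, Finset.card_univ, Fintype.card_fin, s.2]

lemma exists_placement_eq {p k : ℕ} (s : SupportSet p k) (π : Equiv.Perm (Fin k)) {j : Fin p}
    (hj : j ∈ s.1) : ∃ i, placement s π i = j := by
  rw [← map_placement s π] at hj
  obtain ⟨i, -, h⟩ := Finset.mem_map.1 hj
  exact ⟨i, h⟩

lemma dataVector_of_notMem {p k : ℕ} (b : Fin k → ℝ) (s : SupportSet p k)
    (π : Equiv.Perm (Fin k)) {j : Fin p} (hj : j ∉ s.1) : dataVector b s π j = 0 :=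
  dif_neg hj

/-! ### The converse for a given dimension -/

/-- The vector `a` with its entries in `J` replaced by zero. -/
def eraseOn {p : ℕ} (a : Fin p → ℝ) (J : Finset (Fin p)) : Fin p → ℝ :=
  fun j => if j ∈ J then 0 else a j

lemma sum_sub_eraseOn_sq {p : ℕ} (a : Fin p → ℝ) (J : Finset (Fin p)) :
    ∑ j, (a j - eraseOn a J j) ^ 2 = ∑ j ∈ J, a j ^ 2 := by
  rw [← Finset.sum_subset (Finset.subset_univ J)]
  · exact Finset.sum_congr rfl fun j hj => by simp [eraseOn, hj]
  · intro j _ hj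
    simp [eraseOn, hj]

lemma sum_sub_eraseOn_map_placement_sq {p k : ℕ} (b : Fin k → ℝ) (s : SupportSet p k)
    (π : Equiv.Perm (Fin k)) (t : Finset (Fin k)) :
    ∑ j, (dataVector b s π j - eraseOn (dataVector b s π) (t.map (placement s π)) j) ^ 2 =
      ∑ i ∈ t, b i ^ 2 := by
  rw [sum_sub_eraseOn_sq, Finset.sum_map]
  simp_rw [dataVector_placement]

/-- What remains of the data vector when the entries with indices in `t` are erased is determined
by the places of the other entries. -/
lemma eraseOn_map_placement_congr {p k : ℕ} (b : Fin k → ℝ) {s s' : SupportSet p k}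
    {π π' : Equiv.Perm (Fin k)} {t : Finset (Fin k)}
    (h : ∀ i ∉ t, placement s π i = placement s' π' i) :
    eraseOn (dataVector b s π) (t.map (placement s π)) =
      eraseOn (dataVector b s' π') (t.map (placement s' π')) := by
  have key : ∀ (s : SupportSet p k) (π : Equiv.Perm (Fin k)) (j : Fin p),
      eraseOn (dataVector b s π) (t.map (placement s π)) j =
        ∑ i ∈ tᶜ, if placement s π i = j then b i else 0 := by
    intro s π j
    by_cases hj : ∃ i, placement s π i = j
    · obtain ⟨i, rfl⟩ := hj
      simp only [eraseOn, Finset.mem_map', dataVector_placement, EmbeddingLike.apply_eq_iff_eq,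
        Finset.sum_ite_eq', Finset.mem_compl]
      split_ifs <;> rfl
    · have h1 : j ∉ s.1 := fun h => hj (exists_placement_eq s π h)
      rw [Finset.sum_eq_zero fun i _ => if_neg fun hi => hj ⟨i, hi⟩]
      simp [eraseOn, dataVector_of_notMem b s π h1]
  ext j
  rw [key, key]
  exact Finset.sum_congr rfl fun i hi => by rw [h i (Finset.mem_compl.1 hi)]

/-- Given the support, at most `|t|!` permutations have prescribed places for the entries with
indices outside `t`. -/
lemma card_filter_placement_le {p k : ℕ} (s : SupportSet p k) (t : Finset (Fin k))
    (e : {i // i ∉ t} ↪ Fin p) :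
    (Finset.univ.filter fun π : Equiv.Perm (Fin k) =>
      (Function.Embedding.subtype _).trans (placement s π) = e).card ≤ t.card.factorial := by
  classical
  rcases Finset.eq_empty_or_nonempty (Finset.univ.filter fun π : Equiv.Perm (Fin k) =>
      (Function.Embedding.subtype _).trans (placement s π) = e) with h | ⟨π₀, h₀⟩
  · rw [h]; simp
  have hcard : (Finset.univ.filter fun τ : Equiv.Perm (Fin k) => ∀ i, i ∉ t → τ i = i).card =
      t.card.factorial := by
    rw [← Fintype.card_subtype,
      ← Fintype.card_congr (Equiv.Perm.subtypeEquivSubtypePerm fun i => i ∈ t),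
      Fintype.card_perm, Fintype.card_coe]
  rw [← hcard]
  refine Finset.card_le_card_of_injOn (fun π => π * π₀⁻¹) ?_ fun π _ π' _ h => mul_right_cancel h
  intro π hπ
  simp only [Finset.coe_filter, Finset.mem_univ, true_and, Set.mem_ofPred_eq] at hπ ⊢
  simp only [Finset.mem_filter, Finset.mem_univ, true_and] at h₀
  intro i hi
  have h1 : placement s π i = placement s π₀ i := by
    have := DFunLike.congr_fun (hπ.trans h₀.symm) ⟨i, hi⟩
    exact this
  rw [placement_apply, placement_apply] at h1
  have h2 : π.symm i = π₀.symm i := (s.1.orderIsoOfFin s.2).injective (Subtype.ext h1)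
  rw [Equiv.Perm.mul_apply, Equiv.Perm.inv_def, ← h2, Equiv.apply_symm_apply]

/-- Guessing the support when the observations carry no information on the places of the entries
with indices in `t`: the number of successes, summed over supports and permutations. -/
lemma sum_dataLaw_eraseOn_le {p k n : ℕ} (s₀ : ℝ) (b : Fin k → ℝ) (d : Decoder p n)
    (t : Finset (Fin k)) :
    ∑ s : SupportSet p k, ∑ π : Equiv.Perm (Fin k), dataLaw n p s₀
      {q | (q.1, linearObservations
        (eraseOn (dataVector b s π) (t.map (placement s π))) q) ∈ {r | d.estimate r = s.1}} ≤
      ((t.card.factorial * p.descFactorial (k - t.card) : ℕ) : ENNReal) := by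
  classical
  set E := {i // i ∉ t} ↪ Fin p
  let ρ : SupportSet p k → Equiv.Perm (Fin k) → E := fun s π =>
    (Function.Embedding.subtype _).trans (placement s π)
  -- the known part as a function of the revealed places
  have hc : ∃ c : E → Fin p → ℝ, ∀ s π,
      eraseOn (dataVector b s π) (t.map (placement s π)) = c (ρ s π) := by
    let c : E → Fin p → ℝ := fun e => if h : ∃ τ : SupportSet p k × Equiv.Perm (Fin k),
      ρ τ.1 τ.2 = e then eraseOn (dataVector b h.choose.1 h.choose.2)
        (t.map (placement h.choose.1 h.choose.2)) else 0
    refine ⟨c, fun s π => ?_⟩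
    have h : ∃ τ : SupportSet p k × Equiv.Perm (Fin k), ρ τ.1 τ.2 = ρ s π := ⟨(s, π), rfl⟩
    simp only [c, dif_pos h]
    refine eraseOn_map_placement_congr b fun i hi => ?_
    exact (DFunLike.congr_fun h.choose_spec ⟨i, hi⟩).symm
  obtain ⟨c, hc⟩ := hc
  simp_rw [hc]
  let F : E → SupportSet p k → ENNReal := fun e s => dataLaw n p s₀
    {q | (q.1, linearObservations (c e) q) ∈ {r | d.estimate r = s.1}}
  have hF : ∀ e, ∑ s, F e s ≤ 1 := by
    intro e
    rw [← measure_univ (μ := dataLaw n p s₀)]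
    refine sum_measure_le_measure_univ (fun s _ => ?_) ?_
    · have h1 : Measurable fun q : (Fin n → Fin p → ℝ) × (Fin n → ℝ) =>
          (q.1, linearObservations (c e) q) := by fun_prop
      exact ((d.measurable_estimate.comp h1) (MeasurableSet.singleton s.1)).nullMeasurableSet
    · intro s _ s' _ hs
      refine Disjoint.aedisjoint (Set.disjoint_left.2 fun q hq hq' => hs ?_)
      exact Subtype.ext (Eq.trans (Eq.symm hq) hq')
  have hE : Fintype.card E = p.descFactorial (k - t.card) := by
    rw [Fintype.card_embedding_eq, Fintype.card_fin]
    congr 1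
    rw [Fintype.card_subtype_compl, Fintype.card_fin, Fintype.card_coe]
  calc ∑ s, ∑ π, F (ρ s π) s
      = ∑ s, ∑ e, ∑ π ∈ Finset.univ.filter (fun π => ρ s π = e), F (ρ s π) s :=
        Finset.sum_congr rfl fun s _ => (Finset.sum_fiberwise _ _ _).symm
    _ = ∑ s, ∑ e, (Finset.univ.filter fun π => ρ s π = e).card • F e s := by
        refine Finset.sum_congr rfl fun s _ => Finset.sum_congr rfl fun e _ => ?_
        refine Finset.sum_eq_card_nsmul fun π hπ => ?_
        rw [(Finset.mem_filter.1 hπ).2]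
    _ ≤ ∑ s, ∑ e, t.card.factorial • F e s := by
        refine Finset.sum_le_sum fun s _ => Finset.sum_le_sum fun e _ => ?_
        exact nsmul_le_nsmul_left (zero_le) (card_filter_placement_le s t e)
    _ = t.card.factorial • ∑ e, ∑ s, F e s := by
        rw [Finset.sum_comm]
        simp_rw [← Finset.smul_sum]
    _ ≤ t.card.factorial • ∑ e : E, 1 := by
        gcongr with e
        exact hF e
    _ = _ := by
        rw [Finset.sum_const, Finset.card_univ, hE]
        simp

lemma factorial_mul_descFactorial_mul_choose {p k l : ℕ} (hkp : k ≤ p) (hl : l ≤ k) :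
    l.factorial * p.descFactorial (k - l) * (p - k + l).choose l = p.descFactorial k := by
  have h1 : p - k + l = p - (k - l) := by omega
  have h2 : k = (k - l) + l := by omega
  have h3 : (p - (k - l)).descFactorial l * p.descFactorial (k - l) = p.descFactorial k := by
    have := Nat.descFactorial_mul_descFactorial (n := p) (show k - l ≤ k by omega)
    rwa [show k - (k - l) = l by omega] at this
  rw [h1, ← h3, Nat.descFactorial_eq_factorial_mul_choose (p - (k - l)) l]
  ring

/-- The converse for a given dimension: if the information in `n` measurements on the entries
with indices in `t` is less than the logarithm of the number of their possible places, by a factor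
`1 - η`, then every decoder errs with high probability. -/
lemma one_sub_exp_le_errorProb {p k n : ℕ} (hkp : k ≤ p) {σ : ℝ} (hσ : 0 < σ) {b : Fin k → ℝ}
    (t : Finset (Fin k)) {η : ℝ} (hη : 0 < η) (hη1 : η ≤ 1)
    (hn : n * (1 / 2 * log (1 + (∑ i ∈ t, b i ^ 2) / σ ^ 2)) ≤
      (1 - η) * log ((p - k + t.card).choose t.card : ℝ))
    (d : Decoder p n) :
    1 - (exp (-(η ^ 2 / 32) * log ((p - k + t.card).choose t.card : ℝ)) +
      exp (-(η / 2) * log ((p - k + t.card).choose t.card : ℝ))) ≤ errorProb σ b d := by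
  have hl : t.card ≤ k := by simpa using Finset.card_le_univ t
  set M := (p - k + t.card).choose t.card with hM
  have hM0 : 0 < M := Nat.choose_pos (by omega)
  set L := log (M : ℝ) with hL
  have hL0 : 0 ≤ L := Real.log_natCast_nonneg M
  set v := ∑ i ∈ t, b i ^ 2 with hv
  have hv0 : 0 ≤ v := Finset.sum_nonneg fun i _ => sq_nonneg _
  have hs : 0 < σ ^ 2 := by positivity
  refine one_sub_le_errorProb hkp (by positivity) ?_
  have hone : ∀ (s : SupportSet p k) (π : Equiv.Perm (Fin k)), dataLaw n p (σ ^ 2)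
      {q | d.estimate (q.1, linearObservations (dataVector b s π) q) = s.1} ≤
      ENNReal.ofReal (exp (-(η ^ 2 / 32) * L)) + ENNReal.ofReal (exp ((1 - η / 2) * L)) *
        dataLaw n p (σ ^ 2 + v) {q | (q.1, linearObservations
          (eraseOn (dataVector b s π) (t.map (placement s π))) q) ∈ {r | d.estimate r = s.1}} := by
    intro s π
    set a := dataVector b s π
    set c := eraseOn a (t.map (placement s π))
    have hvc : ∑ j, (a j - c j) ^ 2 = v := sum_sub_eraseOn_map_placement_sq b s π t
    -- Chernoff's bound with parameter `η / 8`, for a deviation of `(η / 2) L`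
    have h1 := dataLaw_le_mul_infoDensity_sub_le (n := n) hs c a (l := η / 8)
      (by rw [abs_of_pos (by positivity)]; linarith) (η / 8 * (η / 2 * L))
    have h2 := dataLaw_infoDensity_le_le (n := n) hs hv0 c a ((1 - η / 2) * L)
      (D := {r | d.estimate r = s.1}) (d.measurable_estimate (MeasurableSet.singleton _))
    rw [hvc] at h1
    refine (measure_mono fun q hq => ?_).trans ((measure_union_le _ _).trans
      (add_le_add (h1.trans (ENNReal.ofReal_le_ofReal (Real.exp_le_exp.2 ?_))) h2))
    · by_cases hi : infoDensity (σ ^ 2) v c a (q.1, linearObservations a q) ≤ (1 - η / 2) * L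
      · exact Or.inr ⟨hq, hi⟩
      · left
        push Not at hi
        simp only [Set.mem_ofPred_eq]
        refine mul_le_mul_of_nonneg_left ?_ (by positivity)
        linarith
    · have : 2 * (η / 8) ^ 2 * (n * (1 / 2 * log (1 + v / σ ^ 2))) ≤ 2 * (η / 8) ^ 2 * L := by
        refine mul_le_mul_of_nonneg_left (hn.trans ?_) (by positivity)
        nlinarith
      nlinarith
  calc _ ≤ ∑ s : SupportSet p k, ∑ π : Equiv.Perm (Fin k),
        (ENNReal.ofReal (exp (-(η ^ 2 / 32) * L)) + ENNReal.ofReal (exp ((1 - η / 2) * L)) *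
        dataLaw n p (σ ^ 2 + v) {q | (q.1, linearObservations
          (eraseOn (dataVector b s π) (t.map (placement s π))) q) ∈ {r | d.estimate r = s.1}}) :=
        Finset.sum_le_sum fun s _ => Finset.sum_le_sum fun π _ => hone s π
    _ = ENNReal.ofReal (exp (-(η ^ 2 / 32) * L)) * p.descFactorial k +
        ENNReal.ofReal (exp ((1 - η / 2) * L)) * ∑ s : SupportSet p k, ∑ π : Equiv.Perm (Fin k),
        dataLaw n p (σ ^ 2 + v) {q | (q.1, linearObservations
          (eraseOn (dataVector b s π) (t.map (placement s π))) q) ∈ {r | d.estimate r = s.1}} := by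
        simp_rw [Finset.sum_add_distrib, ← Finset.mul_sum]
        congr 1
        rw [Finset.sum_const, Finset.sum_const, nsmul_eq_mul, nsmul_eq_mul, Finset.card_univ,
          Finset.card_univ, ← mul_assoc, ← Nat.cast_mul, card_supportSet_mul_card_perm, mul_comm]
    _ ≤ ENNReal.ofReal (exp (-(η ^ 2 / 32) * L)) * p.descFactorial k +
        ENNReal.ofReal (exp ((1 - η / 2) * L)) *
          ((t.card.factorial * p.descFactorial (k - t.card) : ℕ) : ENNReal) := by
        gcongr
        exact sum_dataLaw_eraseOn_le _ b d t
    _ = _ := by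
        rw [ENNReal.ofReal_add (Real.exp_pos _).le (Real.exp_pos _).le, add_mul]
        congr 1
        rw [← factorial_mul_descFactorial_mul_choose hkp hl, ← hM, Nat.cast_mul _ M]
        have h3 : exp ((1 - η / 2) * L) = exp (-(η / 2) * L) * M := by
          rw [show (1 - η / 2) * L = -(η / 2) * L + L by ring, Real.exp_add, hL,
            Real.exp_log (by exact_mod_cast hM0)]
        rw [h3, ENNReal.ofReal_mul (Real.exp_pos _).le, ENNReal.ofReal_natCast]
        ring

/-! ### The threshold decoder for a given dimension -/

/-- A family of measurable tests, one for each support, gives a decoder that is right whenever the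
true support is the only one that passes its test. -/
lemma exists_decoder {p k n : ℕ} (P : SupportSet p k → (Fin n → Fin p → ℝ) × (Fin n → ℝ) → Prop)
    (hP : ∀ s, MeasurableSet {r | P s r}) :
    ∃ d : Decoder p n, ∀ r s, P s r → (∀ s', s' ≠ s → ¬ P s' r) → d.estimate r = s.1 := by
  classical
  let g : (SupportSet p k → Prop) → Finset (Fin p) := fun F =>
    if h : ∃ s, F s then h.choose.1 else ∅
  have hm : Measurable fun (r : (Fin n → Fin p → ℝ) × (Fin n → ℝ)) s => P s r :=
    measurable_pi_iff.2 fun s => measurableSet_setOfPred.1 (hP s)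
  refine ⟨⟨fun r => g fun s => P s r, (measurable_of_countable g).comp hm⟩, fun r s hs hs' => ?_⟩
  have h : ∃ s, P s r := ⟨s, hs⟩
  have h1 : h.choose = s := by
    by_contra hne
    exact hs' _ hne h.choose_spec
  simp only [g, dif_pos h, h1]

lemma sum_pow_Icc_le {q : ℝ} (hq0 : 0 ≤ q) (hq : q ≤ 1 / 2) (k : ℕ) :
    ∑ l ∈ Finset.Icc 1 k, q ^ l ≤ 2 * q := by
  have h : ∀ k : ℕ, ∑ l ∈ Finset.Icc 1 k, q ^ l + 2 * q ^ (k + 1) ≤ 2 * q := by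
    intro k
    induction k with
    | zero => simp
    | succ k ih =>
      rw [Finset.sum_Icc_succ_top (by omega)]
      have h1 : 0 ≤ q ^ (k + 1) := by positivity
      have h2 : q ^ (k + 1 + 1) = q ^ (k + 1) * q := pow_succ _ _
      nlinarith
  have := h k
  have h1 : 0 ≤ q ^ (k + 1) := by positivity
  linarith

/-- A union bound over a family graded by `g`, with at most `K l` members of degree `l`. -/
lemma sum_le_of_card_fiber_le {α : Type*} (T : Finset α) (g : α → ℕ) (k : ℕ) (K : ℕ → ℝ)
    {A : ℝ} (hA : 1 ≤ A) (hg : ∀ x ∈ T, g x ∈ Finset.Icc 1 k)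
    (hK : ∀ l ∈ Finset.Icc 1 k, 0 < K l ∧ ((T.filter fun x => g x = l).card : ℝ) ≤ K l) :
    ∑ x ∈ T, exp (-(A * g x)) / K (g x) ≤ 2 * exp (-A) := by
  have he : exp (-A) ≤ 1 / 2 := by
    rw [Real.exp_neg, one_div]
    apply inv_anti₀ two_pos
    have := Real.add_one_le_exp A
    linarith
  calc ∑ x ∈ T, exp (-(A * g x)) / K (g x)
      = ∑ l ∈ Finset.Icc 1 k, ∑ x ∈ T.filter (fun x => g x = l), exp (-(A * g x)) / K (g x) :=
        (Finset.sum_fiberwise_of_maps_to hg _).symm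
    _ ≤ ∑ l ∈ Finset.Icc 1 k, exp (-A) ^ l := by
        refine Finset.sum_le_sum fun l hl => ?_
        have h1 : ∀ x ∈ T.filter (fun x => g x = l), exp (-(A * g x)) / K (g x) =
            exp (-A) ^ l / K l := by
          intro x hx
          rw [(Finset.mem_filter.1 hx).2, ← Real.exp_nat_mul]
          ring_nf
        rw [Finset.sum_eq_card_nsmul h1, nsmul_eq_mul, mul_div_assoc', div_le_iff₀ (hK l hl).1,
          mul_comm]
        exact mul_le_mul_of_nonneg_left (hK l hl).2 (by positivity)
    _ ≤ _ := sum_pow_Icc_le (Real.exp_pos _).le he k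

/-- On a given support there are at most `m_β ^ k` data vectors. -/
lemma card_image_dataVector_le {p k : ℕ} (b : Fin k → ℝ) (s : SupportSet p k) :
    (Finset.univ.image (dataVector b s)).card ≤ numDistinct b ^ k := by
  have h1 : Finset.univ.image (dataVector b s) ⊆
      (Fintype.piFinset fun _ : Fin k => Finset.univ.image b).image
        fun (f : Fin k → ℝ) (j : Fin p) =>
          if h : j ∈ s.1 then f ((s.1.orderIsoOfFin s.2).symm ⟨j, h⟩) else 0 := by
    intro a ha
    obtain ⟨π, -, rfl⟩ := Finset.mem_image.1 ha
    exact Finset.mem_image.2 ⟨fun i => b (π i), by simp, rfl⟩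
  refine (Finset.card_le_card h1).trans (Finset.card_image_le.trans ?_)
  rw [Fintype.card_piFinset_const]
  have : numDistinct b = (Finset.univ.image b).card := by
    rw [numDistinct, ← Set.ncard_coe_finset]
    simp
  rw [this]

/-- A support is determined by the elements of `s` that it misses and the ones that it adds. -/
lemma card_filter_card_sdiff_le {p k : ℕ} (s : SupportSet p k) (l : ℕ) :
    (Finset.univ.filter fun s' : SupportSet p k => (s'.1 \ s.1).card = l).card ≤
      k.choose l * (p - k).choose l := by
  classical
  have h1 : (s.1.powersetCard l ×ˢ (s.1ᶜ).powersetCard l).card =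
      k.choose l * (p - k).choose l := by
    rw [Finset.card_product, Finset.card_powersetCard, Finset.card_powersetCard,
      Finset.card_compl, s.2, Fintype.card_fin]
  rw [← h1]
  refine Finset.card_le_card_of_injOn (fun s' => (s.1 \ s'.1, s'.1 \ s.1)) ?_ ?_
  · intro s' hs'
    have hs2 : (s'.1 \ s.1).card = l := by simpa using hs'
    rw [Finset.mem_coe, Finset.mem_product, Finset.mem_powersetCard, Finset.mem_powersetCard]
    refine ⟨⟨Finset.sdiff_subset, ?_⟩, ⟨fun j hj => ?_, hs2⟩⟩
    · rw [← hs2]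
      exact Finset.card_sdiff_comm (s.2.trans s'.2.symm)
    · exact Finset.mem_compl.2 (Finset.mem_sdiff.1 hj).2
  · intro s' _ s'' _ h
    simp only [Prod.mk.injEq] at h
    have key : ∀ u : Finset (Fin p), u = (s.1 \ (s.1 \ u)) ∪ (u \ s.1) := by
      intro u
      ext j
      simp only [Finset.mem_union, Finset.mem_sdiff]
      tauto
    apply Subtype.ext
    rw [key s'.1, key s''.1, h.1, h.2]

/-- The information, in nats, of one measurement on the entries with indices in `t`. -/
noncomputable def information {k : ℕ} (σ : ℝ) (b : Fin k → ℝ) (t : Finset (Fin k)) : ℝ :=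
  1 / 2 * log (1 + (∑ i ∈ t, b i ^ 2) / σ ^ 2)

/-- The test of the threshold decoder: some arrangement of the entries on the support `s` has, for
every nonempty set of its entries, an information density above the threshold. -/
def PassesTest {p k n : ℕ} (σ : ℝ) (b : Fin k → ℝ) (δ : ℝ) (s : SupportSet p k)
    (r : (Fin n → Fin p → ℝ) × (Fin n → ℝ)) : Prop :=
  ∃ π : Equiv.Perm (Fin k), ∀ t : Finset (Fin k), t.Nonempty →
    (1 - δ) * (n * information σ b t) < infoDensity (σ ^ 2) (∑ i ∈ t, b i ^ 2)
      (eraseOn (dataVector b s π) (t.map (placement s π))) (dataVector b s π) r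

lemma measurableSet_passesTest {p k n : ℕ} (σ : ℝ) (b : Fin k → ℝ) (δ : ℝ) (s : SupportSet p k) :
    MeasurableSet {r : (Fin n → Fin p → ℝ) × (Fin n → ℝ) | PassesTest σ b δ s r} := by
  have : {r : (Fin n → Fin p → ℝ) × (Fin n → ℝ) | PassesTest σ b δ s r} =
      ⋃ π : Equiv.Perm (Fin k), ⋂ t : Finset (Fin k), ⋂ _ : t.Nonempty,
        {r | (1 - δ) * (n * information σ b t) < infoDensity (σ ^ 2) (∑ i ∈ t, b i ^ 2)
          (eraseOn (dataVector b s π) (t.map (placement s π))) (dataVector b s π) r} := by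
    ext r
    simp [PassesTest]
  rw [this]
  exact MeasurableSet.iUnion fun π => MeasurableSet.iInter fun t => MeasurableSet.iInter fun _ =>
    measurableSet_lt measurable_const (measurable_infoDensity _ _ _ _)

/-- The true support seldom fails its test. -/
lemma dataLaw_not_passesTest_le {p k n : ℕ} {σ : ℝ} (hσ : 0 < σ) {b : Fin k → ℝ} {δ A : ℝ}
    (hδ : 0 < δ) (hδ1 : δ ≤ 1) (hA : 1 ≤ A)
    (h : ∀ t : Finset (Fin k), t.Nonempty →
      log (k.choose t.card) + A * t.card ≤ δ ^ 2 / 8 * (n * information σ b t))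
    (s : SupportSet p k) (π : Equiv.Perm (Fin k)) :
    dataLaw n p (σ ^ 2) {q | ¬ PassesTest σ b δ s (q.1, linearObservations (dataVector b s π) q)} ≤
      ENNReal.ofReal (2 * exp (-A)) := by
  set T : Finset (Finset (Fin k)) := Finset.univ.filter fun t => t.Nonempty with hT
  set a := dataVector b s π with ha
  have hs : 0 < σ ^ 2 := by positivity
  calc _ ≤ dataLaw n p (σ ^ 2) (⋃ t ∈ T, {q | δ / 4 * (δ * (n * information σ b t)) ≤
        -(δ / 4) * (infoDensity (σ ^ 2) (∑ i ∈ t, b i ^ 2) (eraseOn a (t.map (placement s π))) a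
          (q.1, linearObservations a q) - n * information σ b t)}) := by
        refine measure_mono fun q hq => ?_
        simp only [PassesTest, Set.mem_ofPred_eq] at hq
        push Not at hq
        obtain ⟨t, ht, hle⟩ := hq π
        refine Set.mem_biUnion (x := t) (by simpa [hT] using ht) ?_
        rw [Set.mem_ofPred_eq, neg_mul, ← mul_neg]
        refine mul_le_mul_of_nonneg_left ?_ (by positivity)
        rw [← ha] at hle
        linarith
    _ ≤ ∑ t ∈ T, ENNReal.ofReal (exp (-(A * t.card)) / k.choose t.card) := by
        refine (measure_biUnion_finset_le _ _).trans (Finset.sum_le_sum fun t ht => ?_)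
        have h1 := dataLaw_le_mul_infoDensity_sub_le (n := n) hs (eraseOn a (t.map (placement s π)))
          a (l := -(δ / 4)) (by rw [abs_neg, abs_of_pos (by positivity)]; linarith)
          (δ / 4 * (δ * (n * information σ b t)))
        rw [sum_sub_eraseOn_map_placement_sq] at h1
        refine h1.trans (ENNReal.ofReal_le_ofReal ?_)
        have h2 := h t (by simpa [hT] using ht)
        have h3 : 0 < (k.choose t.card : ℝ) := by
          exact_mod_cast Nat.choose_pos (by simpa using Finset.card_le_univ t)
        rw [← Real.exp_log h3, ← Real.exp_sub]
        refine Real.exp_le_exp.2 ?_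
        change 2 * (-(δ / 4)) ^ 2 * (n * information σ b t) - _ ≤ _
        nlinarith
    _ ≤ _ := by
        rw [← ENNReal.ofReal_sum_of_nonneg fun t _ => by positivity]
        refine ENNReal.ofReal_le_ofReal ?_
        refine sum_le_of_card_fiber_le T Finset.card k (fun l => (k.choose l : ℝ)) hA ?_ ?_
        · intro t ht
          rw [Finset.mem_Icc]
          exact ⟨Finset.card_pos.2 (by simpa [hT] using ht), by simpa using Finset.card_le_univ t⟩
        · intro l hl
          refine ⟨by exact_mod_cast Nat.choose_pos (Finset.mem_Icc.1 hl).2, ?_⟩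
          have : (T.filter fun t => t.card = l) ⊆ Finset.univ.powersetCard l := by
            intro t ht
            rw [Finset.mem_powersetCard]
            exact ⟨Finset.subset_univ _, (Finset.mem_filter.1 ht).2⟩
          have h2 := Finset.card_le_card this
          rw [Finset.card_powersetCard, Finset.card_univ, Fintype.card_fin] at h2
          exact_mod_cast h2

/-- The other supports seldom pass their tests: the test of `s'` includes the information density
of the entries that `s'` places outside the true support. -/
lemma dataLaw_passesTest_le {p k n : ℕ} (hkp : 2 * k ≤ p) {σ : ℝ} (hσ : 0 < σ) {b : Fin k → ℝ}
    {δ A : ℝ} (hA : 1 ≤ A)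
    (h : ∀ t : Finset (Fin k), t.Nonempty →
      log (k.choose t.card) + log ((p - k).choose t.card) + k * log (numDistinct b) +
        A * t.card ≤ (1 - δ) * (n * information σ b t))
    (s : SupportSet p k) (π : Equiv.Perm (Fin k)) :
    dataLaw n p (σ ^ 2) {q | ∃ s', s' ≠ s ∧
      PassesTest σ b δ s' (q.1, linearObservations (dataVector b s π) q)} ≤
      ENNReal.ofReal (2 * exp (-A)) := by
  classical
  set β := dataVector b s π with hβ
  have hs : 0 < σ ^ 2 := by positivity
  set T : Finset (SupportSet p k) := Finset.univ.filter fun s' => s' ≠ s with hT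
  have hpos : ∀ s' ∈ T, (s'.1 \ s.1).card ∈ Finset.Icc 1 k := by
    intro s' hs'
    rw [Finset.mem_Icc, Nat.one_le_iff_ne_zero, Finset.card_ne_zero, Finset.sdiff_nonempty]
    refine ⟨fun hsub => (Finset.mem_filter.1 hs').2 (Subtype.ext ?_), ?_⟩
    · exact Finset.eq_of_subset_of_card_le hsub (s.2.trans s'.2.symm).le
    · exact (Finset.card_le_card Finset.sdiff_subset).trans s'.2.le
  have hK : ∀ l ∈ Finset.Icc 1 k, 0 < (k.choose l * (p - k).choose l : ℝ) := by
    intro l hl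
    have := (Finset.mem_Icc.1 hl).2
    have h1 : 0 < k.choose l := Nat.choose_pos this
    have h2 : 0 < (p - k).choose l := Nat.choose_pos (by omega)
    positivity
  have hone : ∀ s' ∈ T, dataLaw n p (σ ^ 2)
      {q | PassesTest σ b δ s' (q.1, linearObservations β q)} ≤
      ENNReal.ofReal (exp (-(A * (s'.1 \ s.1).card)) /
        (k.choose (s'.1 \ s.1).card * (p - k).choose (s'.1 \ s.1).card)) := by
    intro s' hs'
    set W := Finset.univ.image (dataVector b s') with hW
    set l := (s'.1 \ s.1).card with hl
    have hl1 := hpos s' hs'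
    have hk0 : 0 < k := lt_of_lt_of_le (Finset.mem_Icc.1 hl1).1 (Finset.mem_Icc.1 hl1).2
    have hN : 0 < numDistinct b := by
      rw [numDistinct, Set.ncard_pos (Set.finite_range b)]
      exact ⟨b ⟨0, hk0⟩, Set.mem_range_self _⟩
    have hN' : (0 : ℝ) < (numDistinct b : ℝ) ^ k := by positivity
    set B := exp (-(A * l)) / (k.choose l * (p - k).choose l) / (numDistinct b : ℝ) ^ k with hB
    have hperm : ∀ π' : Equiv.Perm (Fin k), ∃ t : Finset (Fin k), t.Nonempty ∧
        t.map (placement s' π') = s'.1 \ s.1 ∧ t.card = l := by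
      intro π'
      refine ⟨Finset.univ.filter fun i => placement s' π' i ∉ s.1, ?_⟩
      have hm : (Finset.univ.filter fun i => placement s' π' i ∉ s.1).map (placement s' π') =
          s'.1 \ s.1 := by
        ext j
        simp only [Finset.mem_map, Finset.mem_filter, Finset.mem_univ, true_and, Finset.mem_sdiff]
        constructor
        · rintro ⟨i, hi, rfl⟩
          exact ⟨placement_mem s' π' i, hi⟩
        · rintro ⟨h1, h2⟩
          obtain ⟨i, rfl⟩ := exists_placement_eq s' π' h1
          exact ⟨i, h2, rfl⟩
      have hc : (Finset.univ.filter fun i => placement s' π' i ∉ s.1).card = l := by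
        rw [hl, ← hm, Finset.card_map]
      refine ⟨?_, hm, hc⟩
      rw [← Finset.card_pos, hc]
      exact (Finset.mem_Icc.1 hl1).1
    set G := A * l + log (k.choose l) + log ((p - k).choose l) + k * log (numDistinct b) with hG
    -- one event for each data vector, although several permutations may give the same vector
    set E : (Fin p → ℝ) → Set ((Fin n → Fin p → ℝ) × (Fin n → ℝ)) := fun a =>
      {q | G < infoDensity (σ ^ 2) (∑ j, (a j - eraseOn a (s'.1 \ s.1) j) ^ 2)
          (eraseOn a (s'.1 \ s.1)) a (q.1, linearObservations β q)} with hE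
    have hEle : ∀ a, dataLaw n p (σ ^ 2) (E a) ≤ ENNReal.ofReal B := by
      intro a
      refine (dataLaw_lt_infoDensity_le hs (fun j => ?_) _).trans
        (ENNReal.ofReal_le_ofReal (le_of_eq ?_))
      · by_cases hj : j ∈ s'.1 \ s.1
        · left
          have : β j = 0 := dataVector_of_notMem b s π (Finset.mem_sdiff.1 hj).2
          simp [eraseOn, hj, this]
        · right
          simp [eraseOn, hj]
      · have h0 := (Finset.mem_Icc.1 hl1).2
        have h1 : 0 < (k.choose l : ℝ) := by exact_mod_cast Nat.choose_pos h0
        have h2 : 0 < ((p - k).choose l : ℝ) := by exact_mod_cast Nat.choose_pos (by omega)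
        rw [hB, div_div, ← Real.exp_log (mul_pos (mul_pos h1 h2) hN'), ← Real.exp_sub,
          Real.log_mul (mul_pos h1 h2).ne' hN'.ne', Real.log_mul h1.ne' h2.ne', Real.log_pow, hG]
        congr 1
        ring
    calc _ ≤ dataLaw n p (σ ^ 2) (⋃ a ∈ W, E a) := by
          refine measure_mono fun q ⟨π', hq⟩ => ?_
          obtain ⟨t, ht, htm, htc⟩ := hperm π'
          refine Set.mem_biUnion (x := dataVector b s' π')
            (Finset.mem_coe.2 (Finset.mem_image_of_mem _ (Finset.mem_univ π'))) ?_
          have h1 := hq t ht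
          have h2 := h t ht
          rw [htm] at h1
          rw [htc] at h2
          rw [hE, Set.mem_ofPred_eq, ← htm, sum_sub_eraseOn_map_placement_sq, htm]
          refine lt_of_le_of_lt ?_ h1
          linarith
      _ ≤ ∑ a ∈ W, ENNReal.ofReal B :=
          (measure_biUnion_finset_le _ _).trans (Finset.sum_le_sum fun a _ => hEle a)
      _ ≤ ((numDistinct b ^ k : ℕ) : ENNReal) * ENNReal.ofReal B := by
          rw [Finset.sum_const, nsmul_eq_mul]
          gcongr
          exact card_image_dataVector_le b s'
      _ = _ := by
          rw [← ENNReal.ofReal_natCast, ← ENNReal.ofReal_mul (by positivity), hB, Nat.cast_pow,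
            mul_div_cancel₀ _ hN'.ne']
  calc _ ≤ dataLaw n p (σ ^ 2) (⋃ s' ∈ T,
        {q | PassesTest σ b δ s' (q.1, linearObservations β q)}) := by
        refine measure_mono fun q hq => ?_
        obtain ⟨s', hs', hq⟩ := hq
        exact Set.mem_biUnion (x := s') (by simpa [hT] using hs') hq
    _ ≤ ∑ s' ∈ T, ENNReal.ofReal (exp (-(A * (s'.1 \ s.1).card)) /
        (k.choose (s'.1 \ s.1).card * (p - k).choose (s'.1 \ s.1).card)) :=
        (measure_biUnion_finset_le _ _).trans (Finset.sum_le_sum hone)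
    _ ≤ _ := by
        rw [← ENNReal.ofReal_sum_of_nonneg fun s' _ => by positivity]
        refine ENNReal.ofReal_le_ofReal ?_
        refine sum_le_of_card_fiber_le T (fun s' => (s'.1 \ s.1).card) k
          (fun l => (k.choose l * (p - k).choose l : ℝ)) hA hpos fun l hl => ⟨hK l hl, ?_⟩
        have h1 : (T.filter fun s' => (s'.1 \ s.1).card = l).card ≤
            k.choose l * (p - k).choose l :=
          (Finset.card_le_card (Finset.filter_subset_filter _ (Finset.subset_univ _))).trans
            (card_filter_card_sdiff_le s l)
        exact_mod_cast h1

/-- Achievability for a given dimension: `h₁` pays for the union bound over the tests of the true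
support, and `h₂` for the one over the other supports and their arrangements. -/
lemma exists_decoder_errorProb_le {p k n : ℕ} (hkp : 2 * k ≤ p) {σ : ℝ} (hσ : 0 < σ)
    {b : Fin k → ℝ} {δ A : ℝ} (hδ : 0 < δ) (hδ1 : δ ≤ 1) (hA : 1 ≤ A)
    (h₁ : ∀ t : Finset (Fin k), t.Nonempty →
      log (k.choose t.card) + A * t.card ≤ δ ^ 2 / 8 * (n * information σ b t))
    (h₂ : ∀ t : Finset (Fin k), t.Nonempty →
      log (k.choose t.card) + log ((p - k).choose t.card) + k * log (numDistinct b) +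
        A * t.card ≤ (1 - δ) * (n * information σ b t)) :
    ∃ d : Decoder p n, errorProb σ b d ≤ 4 * exp (-A) := by
  obtain ⟨d, hd⟩ := exists_decoder (fun s r => PassesTest (n := n) (p := p) σ b δ s r)
    (measurableSet_passesTest σ b δ)
  refine ⟨d, errorProb_le (by omega) (by positivity) fun s π => ?_⟩
  calc _ ≤ dataLaw n p (σ ^ 2)
        ({q | ¬ PassesTest σ b δ s (q.1, linearObservations (dataVector b s π) q)} ∪
          {q | ∃ s', s' ≠ s ∧
            PassesTest σ b δ s' (q.1, linearObservations (dataVector b s π) q)}) := by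
        refine measure_mono fun q hq => ?_
        by_contra hc
        rw [Set.mem_union, not_or] at hc
        refine hq (hd _ s (not_not.1 hc.1) fun s' hs' hP => hc.2 ⟨s', hs', hP⟩)
    _ ≤ ENNReal.ofReal (2 * exp (-A)) + ENNReal.ofReal (2 * exp (-A)) :=
        (measure_union_le _ _).trans (add_le_add
          (dataLaw_not_passesTest_le hσ hδ hδ1 hA h₁ s π)
          (dataLaw_passesTest_le hkp hσ hA h₂ s π))
    _ = _ := by
        rw [← ENNReal.ofReal_add (by positivity) (by positivity)]
        ring_nf

/-! ### Asymptotics of the union bounds -/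

lemma one_le_card_and_card_le {k : ℕ} {t : Finset (Fin k)} (ht : t.Nonempty) :
    1 ≤ t.card ∧ t.card ≤ k :=
  ⟨Finset.card_pos.2 ht, by simpa using Finset.card_le_univ t⟩

lemma mul_log_le_log_choose {p k l : ℕ} (hkp : 4 * k ≤ p) (hl : 1 ≤ l) (hlk : l ≤ k) :
    l * log (p / (2 * k)) ≤ log ((p - k).choose l) := by
  have hk : (0 : ℝ) < k := by exact_mod_cast (by omega : 0 < k)
  have hp : (0 : ℝ) < p := by exact_mod_cast (by omega : 0 < p)
  rw [← Real.log_pow]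
  refine Real.log_le_log (by positivity) (le_trans ?_ (Nat.pow_le_choose l (p - k)))
  rw [le_div_iff₀ (by positivity)]
  have h1 : (l.factorial : ℝ) ≤ (k : ℝ) ^ l := by
    have : l.factorial ≤ k ^ l := (Nat.factorial_le_pow l).trans (Nat.pow_le_pow_left hlk l)
    exact_mod_cast this
  have h2 : (p : ℝ) / 2 ≤ ((p - k + 1 - l : ℕ) : ℝ) := by
    have : p ≤ 2 * (p - k + 1 - l) := by omega
    have : (p : ℝ) ≤ 2 * ((p - k + 1 - l : ℕ) : ℝ) := by exact_mod_cast this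
    linarith
  calc (p / (2 * k) : ℝ) ^ l * l.factorial ≤ (p / (2 * k) : ℝ) ^ l * (k : ℝ) ^ l := by gcongr
    _ = ((p : ℝ) / 2) ^ l := by rw [← mul_pow]; congr 1; field_simp
    _ ≤ _ := by gcongr

lemma log_choose_le_mul_log {k l : ℕ} (hl : 1 ≤ l) (hlk : l ≤ k) :
    log (k.choose l) ≤ l * (1 + log (k / l)) := by
  have hk : (0 : ℝ) < k := by exact_mod_cast (by omega : 0 < k)
  have hl0 : (0 : ℝ) < l := by exact_mod_cast hl
  have h0 : (0 : ℝ) < k.choose l := by exact_mod_cast Nat.choose_pos hlk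
  rw [Real.log_le_iff_le_exp h0, mul_add, mul_one, Real.exp_add, ← Real.log_pow,
    Real.exp_log (by positivity)]
  refine (Nat.choose_le_pow_div l k).trans ?_
  have h1 := Real.pow_div_factorial_le_exp (x := (l : ℝ)) hl0.le l
  rw [div_pow, ← mul_div_assoc, le_div_iff₀ (by positivity)]
  calc (k : ℝ) ^ l / l.factorial * (l : ℝ) ^ l = (l : ℝ) ^ l / l.factorial * (k : ℝ) ^ l := by ring
    _ ≤ _ := by gcongr

lemma log_choose_le_mul_log_self {k l : ℕ} (hlk : l ≤ k) : log (k.choose l) ≤ l * log k := by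
  rw [← Real.log_pow]
  refine Real.log_le_log (by exact_mod_cast Nat.choose_pos hlk) ?_
  exact_mod_cast Nat.choose_le_pow k l

/-- If `k` is at most a power of `p` with exponent below one, the number of possible places of `l`
entries is at least a power of `p` with exponent proportional to `l`. -/
lemma exists_mul_log_le_log_choose {k : ℕ → ℕ} {θ : ℝ} (hθ : θ < 1)
    (hk : (fun p : ℕ => (k p : ℝ)) =O[atTop] fun p : ℕ => (p : ℝ) ^ θ) :
    ∃ κ : ℝ, 0 < κ ∧ ∀ᶠ p in atTop, ∀ l, 1 ≤ l → l ≤ k p →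
      κ * (l * log p) ≤ log ((p - k p).choose l) := by
  set κ := (1 - θ) / 2 with hκ
  have hκ0 : 0 < κ := by linarith
  refine ⟨κ, hκ0, ?_⟩
  obtain ⟨C, hC0, hC⟩ := hk.exists_pos
  have ht : Tendsto (fun p : ℕ => (p : ℝ) ^ κ) atTop atTop :=
    (tendsto_rpow_atTop hκ0).comp tendsto_natCast_atTop_atTop
  filter_upwards [hC.bound, ht.eventually_ge_atTop (4 * C), ht.eventually_ge_atTop 1,
    eventually_ge_atTop 1] with p h1 h2 h3 hp l hl hlk
  have hp0 : (0 : ℝ) < p := by exact_mod_cast hp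
  have hk0 : (0 : ℝ) < k p := by exact_mod_cast (by omega : 0 < k p)
  rw [Real.norm_of_nonneg hk0.le, Real.norm_of_nonneg (by positivity)] at h1
  have h4 : (p : ℝ) = (p : ℝ) ^ θ * (p : ℝ) ^ κ * (p : ℝ) ^ κ := by
    rw [← Real.rpow_add hp0, ← Real.rpow_add hp0, hκ]
    ring_nf
    simp
  have h5 : 4 * (k p : ℝ) * (p : ℝ) ^ κ ≤ p := by
    have hθ0 : 0 ≤ (p : ℝ) ^ θ := by positivity
    have hκ1 : 0 ≤ (p : ℝ) ^ κ := by positivity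
    calc 4 * (k p : ℝ) * (p : ℝ) ^ κ ≤ 4 * (C * (p : ℝ) ^ θ) * (p : ℝ) ^ κ := by gcongr
      _ = (p : ℝ) ^ θ * (4 * C) * (p : ℝ) ^ κ := by ring
      _ ≤ (p : ℝ) ^ θ * (p : ℝ) ^ κ * (p : ℝ) ^ κ := by gcongr
      _ = p := h4.symm
  have h6 : 4 * k p ≤ p := by
    have : 4 * (k p : ℝ) ≤ p := by nlinarith
    exact_mod_cast this
  refine le_trans ?_ (mul_log_le_log_choose h6 hl hlk)
  rw [mul_left_comm, ← Real.log_rpow hp0]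
  refine mul_le_mul_of_nonneg_left (Real.log_le_log (by positivity) ?_) (Nat.cast_nonneg l)
  rw [le_div_iff₀ (by positivity)]
  have : 0 ≤ (k p : ℝ) * (p : ℝ) ^ κ := by positivity
  linarith

/-- For every nonempty set of entries, of cardinality `l` say, the logarithms of `C(k, l)` and of
`m_β ^ k`, a bound on the number of arrangements of the entries, are negligible with respect to the
information in all measurements. The term in `A`, with `A` arbitrarily large, makes the union
bounds summable over `l`, with a small sum. -/
def UnionBoundsNegligible (k : ℕ → ℕ) (σ : ℕ → ℝ) (b : (p : ℕ) → Fin (k p) → ℝ) (n : ℕ → ℕ) :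
    Prop :=
  ∀ ε > 0, ∀ A : ℝ, ∀ᶠ p in atTop, ∀ t : Finset (Fin (k p)), t.Nonempty →
    log ((k p).choose t.card) + k p * log (numDistinct (b p)) + A * t.card ≤
      ε * (n p * information (σ p) (b p) t)

section Regimes

variable {k : ℕ → ℕ} {σ : ℕ → ℝ} {b : (p : ℕ) → Fin (k p) → ℝ} {n : ℕ → ℕ}

lemma tendsto_log_natCast : Tendsto (fun p : ℕ => log (p : ℝ)) atTop atTop :=
  Real.tendsto_log_atTop.comp tendsto_natCast_atTop_atTop

lemma isBigO_rpow_of_isBigO_log_rpow {θ : ℝ}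
    (hk : (fun p : ℕ => (k p : ℝ)) =O[atTop] fun p : ℕ => log p ^ θ) {r : ℝ} (hr : 0 < r) :
    (fun p : ℕ => (k p : ℝ)) =O[atTop] fun p : ℕ => (p : ℝ) ^ r :=
  hk.trans ((isLittleO_log_rpow_rpow_atTop θ hr).comp_tendsto tendsto_natCast_atTop_atTop).isBigO

/-- Supports of size `o(log p)` with boundedly many distinct entries. -/
lemma unionBoundsNegligible_of_isLittleO_log
    (hk : (fun p : ℕ => (k p : ℝ)) =o[atTop] fun p : ℕ => log p)
    (hm : (fun p : ℕ => (numDistinct (b p) : ℝ)) =O[atTop] fun _ : ℕ => (1 : ℝ))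
    (hn : ∀ᶠ p in atTop, ∀ t : Finset (Fin (k p)), t.Nonempty →
      log ((p - k p).choose t.card) ≤ n p * information (σ p) (b p) t) :
    UnionBoundsNegligible k σ b n := by
  intro ε hε A
  have hk1 : (fun p : ℕ => (k p : ℝ)) =O[atTop] fun p : ℕ => log p ^ (1 : ℝ) := by
    simpa using hk.isBigO
  obtain ⟨κ, hκ, hκ'⟩ := exists_mul_log_le_log_choose (θ := 1 / 2) (by norm_num)
    (isBigO_rpow_of_isBigO_log_rpow hk1 (by norm_num))
  obtain ⟨C, hC0, hC⟩ := hm.exists_pos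
  have hD : 0 < log 2 + |log C| + |A| := by
    have := Real.log_pos one_lt_two
    positivity
  filter_upwards [hn, hκ', hC.bound,
    hk.bound (c := ε * κ / (log 2 + |log C| + |A|)) (by positivity),
    eventually_ge_atTop 1] with p h1 h2 h3 h4 hp t ht
  obtain ⟨hl, hlk⟩ := one_le_card_and_card_le ht
  have hlog : 0 ≤ log (p : ℝ) := Real.log_natCast_nonneg p
  rw [Real.norm_of_nonneg (Nat.cast_nonneg _), Real.norm_of_nonneg hlog, div_mul_eq_mul_div,
    le_div_iff₀ hD] at h4
  simp only [norm_one, mul_one, Real.norm_natCast] at h3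
  have e1 : log ((k p).choose t.card) ≤ k p * log 2 := by
    rw [← Real.log_pow]
    exact Real.log_le_log (by exact_mod_cast Nat.choose_pos hlk)
      (by exact_mod_cast Nat.choose_le_two_pow (k p) t.card)
  have e2 : k p * log (numDistinct (b p)) ≤ k p * |log C| := by
    refine mul_le_mul_of_nonneg_left ?_ (Nat.cast_nonneg _)
    rcases Nat.eq_zero_or_pos (numDistinct (b p)) with h0 | h0
    · simp [h0]
    · exact (Real.log_le_log (by exact_mod_cast h0) h3).trans (le_abs_self _)
  have e3 : A * t.card ≤ k p * |A| := by
    have : (t.card : ℝ) ≤ k p := by exact_mod_cast hlk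
    calc A * t.card ≤ |A| * t.card := by gcongr; exact le_abs_self A
      _ ≤ |A| * k p := by gcongr
      _ = _ := mul_comm _ _
  have e4 : ε * κ * log p ≤ ε * (n p * information (σ p) (b p) t) := by
    rw [mul_assoc]
    refine mul_le_mul_of_nonneg_left ?_ hε.le
    refine le_trans ?_ ((h2 _ hl hlk).trans (h1 t ht))
    refine mul_le_mul_of_nonneg_left ?_ hκ.le
    have : (1 : ℝ) ≤ t.card := by exact_mod_cast hl
    exact le_mul_of_one_le_left hlog this
  linarith

/-- Supports of polylogarithmic size with equal entries. -/
lemma unionBoundsNegligible_of_isBigO_log_rpow {θ : ℝ}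
    (hk : (fun p : ℕ => (k p : ℝ)) =O[atTop] fun p : ℕ => log p ^ θ)
    (hm : ∀ᶠ p in atTop, numDistinct (b p) = 1)
    (hn : ∀ᶠ p in atTop, ∀ t : Finset (Fin (k p)), t.Nonempty →
      log ((p - k p).choose t.card) ≤ n p * information (σ p) (b p) t) :
    UnionBoundsNegligible k σ b n := by
  intro ε hε A
  obtain ⟨κ, hκ, hκ'⟩ := exists_mul_log_le_log_choose (θ := 1 / 2) (by norm_num)
    (isBigO_rpow_of_isBigO_log_rpow hk (by norm_num))
  obtain ⟨C, hC0, hC⟩ := (isBigO_rpow_of_isBigO_log_rpow hk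
    (r := ε * κ / 2) (by positivity)).exists_pos
  filter_upwards [hn, hκ', hC.bound, hm,
    tendsto_log_natCast.eventually_ge_atTop ((log C + A) / (ε * κ / 2)),
    eventually_ge_atTop 1] with p h1 h2 h3 h4 h5 hp t ht
  obtain ⟨hl, hlk⟩ := one_le_card_and_card_le ht
  have hp0 : (0 : ℝ) < p := by exact_mod_cast hp
  have hk0 : (0 : ℝ) < k p := by exact_mod_cast (by omega : 0 < k p)
  rw [Real.norm_of_nonneg hk0.le, Real.norm_of_nonneg (by positivity)] at h3
  have e1 : log (k p) ≤ log C + ε * κ / 2 * log p := by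
    rw [← Real.log_rpow hp0, ← Real.log_mul hC0.ne' (by positivity)]
    exact Real.log_le_log hk0 h3
  rw [div_le_iff₀ (by positivity)] at h5
  have e2 : log ((k p).choose t.card) ≤ t.card * log (k p) := log_choose_le_mul_log_self hlk
  have e3 : ε * (κ * (t.card * log p)) ≤ ε * (n p * information (σ p) (b p) t) :=
    mul_le_mul_of_nonneg_left ((h2 _ hl hlk).trans (h1 t ht)) hε.le
  have e4 : (t.card : ℝ) * (log (k p) + A) ≤ t.card * (ε * κ * log p) :=
    mul_le_mul_of_nonneg_left (by linarith) (Nat.cast_nonneg _)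
  rw [h4, Nat.cast_one, Real.log_one, mul_zero, add_zero]
  linarith

lemma abs_eq_bMin_of_numDistinct_eq_one {k : ℕ} {b : Fin k → ℝ} (h : numDistinct b = 1)
    (i : Fin k) : |b i| = bMin b := by
  obtain ⟨x, hx⟩ := Set.ncard_eq_one.1 h
  have h1 : ∀ j, b j = x := fun j => by
    have : b j ∈ Set.range b := Set.mem_range_self j
    rw [hx] at this
    exact this
  have : Nonempty (Fin k) := ⟨i⟩
  simp [bMin, h1]

lemma information_eq_of_numDistinct_eq_one {k : ℕ} {b : Fin k → ℝ} (h : numDistinct b = 1)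
    (σ : ℝ) (t : Finset (Fin k)) :
    information σ b t = 1 / 2 * log (1 + t.card * (bMin b ^ 2 / σ ^ 2)) := by
  have h1 : ∀ i, b i ^ 2 = bMin b ^ 2 := fun i => by
    rw [← abs_eq_bMin_of_numDistinct_eq_one h i, sq_abs]
  unfold information
  simp_rw [h1]
  rw [Finset.sum_const, nsmul_eq_mul, mul_div_assoc]

/-- Supports of polynomial size with equal entries of squared size of order `log k / k`. For sets of
at least `k / log k` entries the number `C(k, l)` is negligible with respect to `C(p - k, l)`; for
smaller sets, the number of measurements that the full support requires is more than enough. -/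
lemma unionBoundsNegligible_of_isTheta_rpow {θ : ℝ} (hθ0 : 0 < θ) (hθ : θ < 1)
    (hk : (fun p : ℕ => (k p : ℝ)) =Θ[atTop] fun p : ℕ => (p : ℝ) ^ θ)
    (hkp : ∀ᶠ p in atTop, k p ≤ p)
    (hσ : (fun p : ℕ => σ p ^ 2) =Θ[atTop] fun _ : ℕ => (1 : ℝ))
    (hb : (fun p : ℕ => bMin (b p) ^ 2) =Θ[atTop] fun p : ℕ => log (k p) / (k p : ℝ))
    (hm : ∀ᶠ p in atTop, numDistinct (b p) = 1)
    (hn : ∀ᶠ p in atTop, ∀ t : Finset (Fin (k p)), t.Nonempty →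
      log ((p - k p).choose t.card) ≤ n p * information (σ p) (b p) t) :
    UnionBoundsNegligible k σ b n := by
  intro ε hε A
  obtain ⟨κ, hκ, hκ'⟩ := exists_mul_log_le_log_choose hθ hk.isBigO
  have hktop : Tendsto (fun p => (k p : ℝ)) atTop atTop := by
    have h1 : Tendsto (fun p : ℕ => (p : ℝ) ^ θ) atTop atTop :=
      (tendsto_rpow_atTop hθ0).comp tendsto_natCast_atTop_atTop
    have h2 : Tendsto (fun p => ‖(k p : ℝ)‖) atTop atTop :=
      hk.tendsto_norm_atTop_iff.2 (tendsto_norm_atTop_atTop.comp h1)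
    simpa using h2
  have hlogk : Tendsto (fun p => log (k p : ℝ)) atTop atTop := Real.tendsto_log_atTop.comp hktop
  have hB : (fun p : ℕ => bMin (b p) ^ 2 / σ p ^ 2) =Θ[atTop]
      fun p : ℕ => log (k p) / (k p : ℝ) := by
    simpa using hb.div hσ
  obtain ⟨c₂, hc₂, hup⟩ := hB.isBigO.exists_pos
  obtain ⟨c₁, hc₁, hlow⟩ := hB.isBigO_symm.exists_pos
  set c₃ := c₁⁻¹ / (1 + c₂) with hc₃
  have hc₃0 : 0 < c₃ := by positivity
  -- `log (1 + c₂ y) = o(y)`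
  have hlog1 : ∀ᶠ y : ℝ in atTop, 2 * log (1 + c₂ * y) ≤ c₃ * κ * ε * y := by
    have h1 : Tendsto (fun y : ℝ => 1 + c₂ * y) atTop atTop :=
      tendsto_atTop_add_const_left _ _ (tendsto_id.const_mul_atTop hc₂)
    have h2 := (Real.isLittleO_log_id_atTop.comp_tendsto h1).bound
      (c := c₃ * κ * ε / (4 * c₂)) (by positivity)
    filter_upwards [h2, eventually_ge_atTop (1 / c₂), eventually_ge_atTop 0] with y hy hy1 hy0
    have h3 : 1 ≤ c₂ * y := by rwa [div_le_iff₀' hc₂] at hy1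
    simp only [Function.comp, id] at hy
    rw [Real.norm_of_nonneg (Real.log_nonneg (by linarith)),
      Real.norm_of_nonneg (by linarith)] at hy
    have h4 : c₃ * κ * ε / (4 * c₂) * (1 + c₂ * y) ≤ c₃ * κ * ε / (4 * c₂) * (2 * (c₂ * y)) :=
      mul_le_mul_of_nonneg_left (by linarith) (by positivity)
    have h5 : c₃ * κ * ε / (4 * c₂) * (2 * (c₂ * y)) = c₃ * κ * ε * y / 2 := by
      field_simp
      ring
    linarith
  -- `log log p = o(log p)`
  have hloglog : ∀ᶠ y : ℝ in atTop, 1 + log y + A ≤ ε * κ * y := by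
    filter_upwards [Real.isLittleO_log_id_atTop.bound (c := ε * κ / 2) (by positivity),
      eventually_ge_atTop ((1 + A) / (ε * κ / 2)), eventually_ge_atTop 1] with y h1 h2 h3
    rw [Real.norm_of_nonneg (Real.log_nonneg h3), id, Real.norm_of_nonneg (by linarith)] at h1
    rw [div_le_iff₀ (by positivity)] at h2
    linarith
  filter_upwards [hn, hκ', hm, hup.bound, hlow.bound, hlogk.eventually hlog1,
    tendsto_log_natCast.eventually hloglog, hlogk.eventually_ge_atTop 1,
    tendsto_log_natCast.eventually_ge_atTop A, eventually_ge_atTop 1, hkp]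
    with p h1 h2 h3 h4 h5 h7 h8 h9 h10 hp h11 t ht
  obtain ⟨hl, hlk⟩ := one_le_card_and_card_le ht
  have hl0 : (0 : ℝ) < t.card := by exact_mod_cast hl
  have hk0 : (0 : ℝ) < k p := by exact_mod_cast (by omega : 0 < k p)
  have hkp' : log (k p) ≤ log p := Real.log_le_log hk0 (by exact_mod_cast h11)
  have hlogp : 0 ≤ log (p : ℝ) := Real.log_natCast_nonneg p
  set K := log (k p : ℝ) with hK
  set B := bMin (b p) ^ 2 / σ p ^ 2 with hBdef
  have hB0 : 0 ≤ B := by positivity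
  have hK0 : 0 < K := by linarith
  rw [Real.norm_of_nonneg hB0, Real.norm_of_nonneg (by positivity)] at h4 h5
  rw [h3, Nat.cast_one, Real.log_one, mul_zero, add_zero]
  rcases le_or_gt (k p : ℝ) (t.card * K) with hcase | hcase
  · have e1 : log (k p / t.card : ℝ) ≤ log (log p) := by
      refine Real.log_le_log (by positivity) (le_trans ?_ hkp')
      rwa [div_le_iff₀' hl0]
    have e2 := log_choose_le_mul_log hl hlk
    have e3 : ε * (κ * (t.card * log p)) ≤ ε * (n p * information (σ p) (b p) t) :=
      mul_le_mul_of_nonneg_left ((h2 _ hl hlk).trans (h1 t ht)) hε.le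
    have e4 : (t.card : ℝ) * (1 + log (k p / t.card) + A) ≤ t.card * (ε * κ * log p) :=
      mul_le_mul_of_nonneg_left (by linarith) hl0.le
    linarith
  · have hk1 : 1 ≤ k p := hl.trans hlk
    have huniv : (Finset.univ : Finset (Fin (k p))).Nonempty := ⟨⟨0, hk1⟩, Finset.mem_univ _⟩
    have e1 : t.card * B ≤ c₂ := by
      calc t.card * B ≤ t.card * (c₂ * (K / k p)) := by gcongr
        _ = c₂ * (t.card * K / k p) := by ring
        _ ≤ c₂ * 1 := by gcongr; rw [div_le_one hk0]; exact hcase.le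
        _ = c₂ := mul_one _
    have e2 : 1 / 2 * (c₃ * (t.card * K / k p)) ≤ information (σ p) (b p) t := by
      rw [information_eq_of_numDistinct_eq_one h3, ← hBdef]
      refine mul_le_mul_of_nonneg_left ?_ (by norm_num)
      have e3 := Real.one_sub_inv_le_log_of_pos (show 0 < 1 + t.card * B by positivity)
      refine le_trans ?_ e3
      have e4 : 1 - (1 + t.card * B)⁻¹ = t.card * B / (1 + t.card * B) := by
        field_simp
        ring
      have e5 : c₁⁻¹ * (K / k p) ≤ B := by
        rwa [inv_mul_le_iff₀ hc₁]
      rw [e4]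
      calc c₃ * (t.card * K / k p) = t.card * (c₁⁻¹ * (K / k p)) / (1 + c₂) := by
            rw [hc₃]; ring
        _ ≤ t.card * B / (1 + t.card * B) := by gcongr
    have e6 : information (σ p) (b p) Finset.univ ≤ 1 / 2 * log (1 + c₂ * K) := by
      rw [information_eq_of_numDistinct_eq_one h3, ← hBdef, Finset.card_univ, Fintype.card_fin]
      refine mul_le_mul_of_nonneg_left (Real.log_le_log (by positivity) ?_) (by norm_num)
      have : (k p : ℝ) * B ≤ k p * (c₂ * (K / k p)) := by gcongr
      have e7 : (k p : ℝ) * (c₂ * (K / k p)) = c₂ * K := by field_simp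
      linarith
    set D := log (1 + c₂ * K) with hD
    have hD0 : 0 < D := Real.log_pos (by nlinarith [mul_pos hc₂ hK0])
    have e8 : κ * (k p * log p) ≤ n p * (1 / 2 * D) := by
      have := (h2 _ hk1 le_rfl).trans (by simpa using h1 Finset.univ huniv)
      refine this.trans ?_
      gcongr
    have e9 : 2 * (t.card * log p) ≤ ε * (n p * information (σ p) (b p) t) := by
      refine le_of_mul_le_mul_right ?_ hD0
      have hq : 0 ≤ 1 / 2 * (c₃ * (t.card * K / k p)) := by positivity
      calc 2 * (t.card * log p) * D = 2 * D * (t.card * log p) := by ring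
        _ ≤ c₃ * κ * ε * K * (t.card * log p) := by gcongr
        _ = ε * (2 * (κ * (k p * log p)) * (1 / 2 * (c₃ * (t.card * K / k p)))) := by
            field_simp
        _ ≤ ε * (2 * (n p * (1 / 2 * D)) * information (σ p) (b p) t) := by gcongr
        _ = ε * (n p * information (σ p) (b p) t) * D := by ring
    have e10 : log ((k p).choose t.card) ≤ t.card * K := log_choose_le_mul_log_self hlk
    have e11 : (t.card : ℝ) * (K + A) ≤ t.card * (2 * log p) :=
      mul_le_mul_of_nonneg_left (by linarith) hl0.le
    linarith

end Regimes

/-! ### From a given dimension to the limit -/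

section Asymptotic

variable {k : ℕ → ℕ} {σ : ℕ → ℝ} {b : (p : ℕ) → Fin (k p) → ℝ}

/-- Achievability, once the union bounds are negligible. -/
lemma exists_tendsto_errorProb_zero {n : ℕ → ℕ} {η : ℝ} (hη : 0 < η)
    (hkp : ∀ᶠ p in atTop, 2 * k p ≤ p) (hσ_pos : ∀ᶠ p in atTop, 0 < σ p)
    (hn : ∀ᶠ p in atTop, ∀ t : Finset (Fin (k p)), t.Nonempty →
      (1 + η) * log ((p - k p).choose t.card) ≤ n p * information (σ p) (b p) t)
    (hu : UnionBoundsNegligible k σ b n) :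
    ∃ d : (p : ℕ) → Decoder p (n p),
      Tendsto (fun p => errorProb (σ p) (b p) (d p)) atTop (𝓝 0) := by
  -- with this `δ`, `(1 - 2 δ) (1 + η) = 1 + η / 2`
  set δ := η / (4 * (1 + η)) with hδ
  have hδ0 : 0 < δ := by positivity
  have hδ1 : δ ≤ 1 / 4 := by
    rw [hδ, div_le_iff₀ (by positivity)]
    linarith
  have hδη : (1 - 2 * δ) * (1 + η) = 1 + η / 2 := by
    rw [hδ]
    field_simp
    ring
  have hev : ∀ ε > 0, ∀ᶠ p in atTop, ∃ d : Decoder p (n p), errorProb (σ p) (b p) d ≤ ε := by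
    intro ε hε
    set A := max 1 (-log (ε / 4)) with hA
    have hAε : 4 * exp (-A) ≤ ε := by
      have : exp (-A) ≤ ε / 4 := by
        rw [← Real.exp_log (show 0 < ε / 4 by positivity)]
        refine Real.exp_le_exp.2 ?_
        have := le_max_right 1 (-log (ε / 4))
        linarith
      linarith
    filter_upwards [hkp, hσ_pos, hn, hu (δ ^ 2 / 8) (by positivity) A] with p h1 h2 h3 h4
    have hI : ∀ t : Finset (Fin (k p)), 0 ≤ n p * information (σ p) (b p) t := by
      intro t
      refine mul_nonneg (Nat.cast_nonneg _) (mul_nonneg (by norm_num) (Real.log_nonneg ?_))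
      have : 0 ≤ (∑ i ∈ t, b p i ^ 2) / σ p ^ 2 :=
        div_nonneg (Finset.sum_nonneg fun i _ => sq_nonneg _) (sq_nonneg _)
      linarith
    obtain ⟨d, hd⟩ := exists_decoder_errorProb_le (n := n p) (b := b p) h1 h2 hδ0 (by linarith)
      (le_max_left 1 (-log (ε / 4)))
      (fun t ht => by
        have h5 := h4 t ht
        have h6 : 0 ≤ k p * log (numDistinct (b p)) :=
          mul_nonneg (Nat.cast_nonneg _) (Real.log_natCast_nonneg _)
        linarith)
      (fun t ht => by
        have h5 := h4 t ht
        have h7 : log ((p - k p).choose t.card) ≤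
            (1 - 2 * δ) * (n p * information (σ p) (b p) t) := by
          have h8 : 0 ≤ log ((p - k p).choose t.card : ℝ) := Real.log_natCast_nonneg _
          calc log ((p - k p).choose t.card : ℝ)
              ≤ (1 + η / 2) * log ((p - k p).choose t.card) :=
                le_mul_of_one_le_left h8 (by linarith)
            _ = (1 - 2 * δ) * ((1 + η) * log ((p - k p).choose t.card)) := by
                rw [← mul_assoc, hδη]
            _ ≤ _ := mul_le_mul_of_nonneg_left (h3 t ht) (by linarith)
        have h9 : δ ^ 2 / 8 * (n p * information (σ p) (b p) t) ≤
            δ * (n p * information (σ p) (b p) t) :=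
          mul_le_mul_of_nonneg_right (by nlinarith) (hI t)
        linarith)
    exact ⟨d, hd.trans hAε⟩
  -- for each `p`, a decoder whose error probability is almost the least
  have hnear : ∀ p, ∃ d : Decoder p (n p), ∀ d' : Decoder p (n p),
      errorProb (σ p) (b p) d ≤ errorProb (σ p) (b p) d' + 1 / ((p : ℝ) + 1) := by
    intro p
    have hne : Nonempty (Decoder p (n p)) := ⟨⟨fun _ => ∅, measurable_const⟩⟩
    have hbdd : BddBelow (Set.range fun d : Decoder p (n p) => errorProb (σ p) (b p) d) :=
      ⟨0, by rintro _ ⟨d, rfl⟩; exact errorProb_nonneg _ _ d⟩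
    obtain ⟨d, hd⟩ := exists_lt_of_ciInf_lt (show (⨅ d : Decoder p (n p), errorProb (σ p) (b p) d) <
      (⨅ d : Decoder p (n p), errorProb (σ p) (b p) d) + 1 / ((p : ℝ) + 1) from
        lt_add_of_pos_right _ (by positivity))
    refine ⟨d, fun d' => hd.le.trans ?_⟩
    gcongr
    exact ciInf_le hbdd d'
  choose d hd using hnear
  refine ⟨d, ?_⟩
  rw [Metric.tendsto_nhds]
  intro ε hε
  filter_upwards [hev (ε / 2) (by positivity),
    (tendsto_one_div_add_atTop_nhds_zero_nat (𝕜 := ℝ)).eventually_lt_const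
      (show 0 < ε / 2 by positivity)] with p ⟨d', hd'⟩ h2
  rw [Real.dist_eq, sub_zero, abs_of_nonneg (errorProb_nonneg _ _ _)]
  linarith [hd p d']

/-- The strong converse, from a set of entries for which the number of measurements is too small. -/
lemma tendsto_errorProb_one {n : ℕ → ℕ} {η : ℝ} (hη : 0 < η) (hη1 : η ≤ 1)
    (hkp : ∀ᶠ p in atTop, 2 * k p ≤ p) (hσ_pos : ∀ᶠ p in atTop, 0 < σ p)
    (hn : ∀ᶠ p in atTop, ∃ t : Finset (Fin (k p)), t.Nonempty ∧
      n p * information (σ p) (b p) t ≤ (1 - η) * log ((p - k p + t.card).choose t.card))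
    (d : (p : ℕ) → Decoder p (n p)) :
    Tendsto (fun p => errorProb (σ p) (b p) (d p)) atTop (𝓝 1) := by
  have hlog : Tendsto (fun p : ℕ => log ((p : ℝ) / 2)) atTop atTop :=
    Real.tendsto_log_atTop.comp (tendsto_natCast_atTop_atTop.atTop_div_const two_pos)
  have hexp : ∀ c : ℝ, 0 < c → Tendsto (fun p : ℕ => exp (-c * log ((p : ℝ) / 2))) atTop (𝓝 0) :=
    fun c hc => Real.tendsto_exp_atBot.comp (hlog.const_mul_atTop_of_neg (neg_lt_zero.2 hc))
  have hlim : Tendsto (fun p : ℕ => 1 - (exp (-(η ^ 2 / 32) * log ((p : ℝ) / 2)) +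
      exp (-(η / 2) * log ((p : ℝ) / 2)))) atTop (𝓝 1) := by
    have := ((hexp (η ^ 2 / 32) (by positivity)).add
      (hexp (η / 2) (by positivity))).const_sub 1
    simpa using this
  refine tendsto_of_tendsto_of_tendsto_of_le_of_le' hlim tendsto_const_nhds ?_ ?_
  · filter_upwards [hkp, hσ_pos, hn, eventually_ge_atTop 1] with p h1 h2 ⟨t, ht, h3⟩ hp
    refine le_trans ?_ (one_sub_exp_le_errorProb (by omega) h2 t hη hη1 h3 (d p))
    have hL : log ((p : ℝ) / 2) ≤ log ((p - k p + t.card).choose t.card : ℝ) := by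
      refine Real.log_le_log (by positivity) ?_
      have h4 : p - k p + 1 ≤ (p - k p + t.card).choose t.card := by
        rw [Nat.choose_symm_of_eq_add (Nat.add_comm _ _)]
        calc p - k p + 1 = (p - k p + 1).choose (p - k p) := by simp
          _ ≤ _ := Nat.choose_le_choose _ (by have := Finset.card_pos.2 ht; omega)
      have h5 : p ≤ 2 * (p - k p + 1) := by omega
      have h6 : (p : ℝ) ≤ 2 * ((p - k p + t.card).choose t.card : ℝ) := by
        exact_mod_cast h5.trans (Nat.mul_le_mul_left 2 h4)
      linarith
    have h7 : ∀ c : ℝ, 0 ≤ c → exp (-c * log ((p - k p + t.card).choose t.card : ℝ)) ≤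
        exp (-c * log ((p : ℝ) / 2)) := fun c hc =>
      Real.exp_le_exp.2 (mul_le_mul_of_nonpos_left hL (neg_nonpos.2 hc))
    linarith [h7 (η ^ 2 / 32) (by positivity), h7 (η / 2) (by positivity)]
  · filter_upwards [hkp] with p hp
    exact errorProb_le_one (by omega) _ _ _

end Asymptotic

lemma information_pos {k : ℕ} {σ : ℝ} (hσ : 0 < σ) {b : Fin k → ℝ} (hb : 0 < bMin b)
    {t : Finset (Fin k)} (ht : t.Nonempty) : 0 < information σ b t := by
  obtain ⟨i, hi⟩ := ht
  have h1 : 0 < b i ^ 2 := by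
    have : 0 < |b i| := hb.trans_le (ciInf_le (Set.finite_range _).bddBelow i)
    rw [← sq_abs]
    positivity
  have h2 : 0 < ∑ i ∈ t, b i ^ 2 :=
    h1.trans_le (Finset.single_le_sum (f := fun i => b i ^ 2) (fun i _ => sq_nonneg _) hi)
  refine mul_pos (by norm_num) (Real.log_pos ?_)
  have : 0 < (∑ i ∈ t, b i ^ 2) / σ ^ 2 := by positivity
  linarith

lemma log_choose_div_information_le_achThreshold (p : ℕ) {k : ℕ} (σ : ℝ) (b : Fin k → ℝ)
    {t : Finset (Fin k)} (ht : t.Nonempty) :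
    log ((p - k).choose t.card) / information σ b t ≤ achThreshold p σ b := by
  have := le_ciSup (f := fun t : {t : Finset (Fin k) // t.Nonempty} =>
    Real.log ((p - k).choose t.1.card : ℝ) /
      ((1 / 2 : ℝ) * Real.log (1 + 1 / σ ^ 2 * ∑ i ∈ t.1, b i ^ 2)))
    (Set.finite_range _).bddAbove ⟨t, ht⟩
  rwa [one_div_mul_eq_div (σ ^ 2)] at this

lemma exists_convThreshold_eq (p : ℕ) {k : ℕ} (hk : 1 ≤ k) (σ : ℝ) (b : Fin k → ℝ) :
    ∃ t : Finset (Fin k), t.Nonempty ∧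
      convThreshold p σ b = log ((p - k + t.card).choose t.card) / information σ b t := by
  have : Nonempty {t : Finset (Fin k) // t.Nonempty} := ⟨⟨{⟨0, hk⟩}, Finset.singleton_nonempty _⟩⟩
  obtain ⟨t, ht⟩ := exists_eq_ciSup_of_finite (f := fun t : {t : Finset (Fin k) // t.Nonempty} =>
    Real.log ((p - k + t.1.card).choose t.1.card : ℝ) /
      ((1 / 2 : ℝ) * Real.log (1 + 1 / σ ^ 2 * ∑ i ∈ t.1, b i ^ 2)))
  refine ⟨t.1, t.2, ?_⟩
  rw [convThreshold, ← ht, one_div_mul_eq_div (σ ^ 2)]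
  rfl

end SupportRecovery

open SupportRecovery in
theorem corollary1
    -- the parameters, all of them functions of the ambient dimension `p`
    (k : ℕ → ℕ) (σ : ℕ → ℝ) (b : (p : ℕ) → Fin (k p) → ℝ)
    (hk_pos : ∀ᶠ p in atTop, 1 ≤ k p)
    (hk : (fun p : ℕ => (k p : ℝ)) =o[atTop] (fun p : ℕ => (p : ℝ)))
    (hσ_pos : ∀ᶠ p in atTop, 0 < σ p)
    (hσ : (fun p : ℕ => σ p ^ 2) =Θ[atTop] (fun _ : ℕ => (1 : ℝ)))
    (hb_pos : ∀ᶠ p in atTop, 0 < bMin (b p))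
    (hb_ratio : (fun p : ℕ => bMin (b p)) =Θ[atTop] (fun p : ℕ => bMax (b p)))
    (hb_bdd : (fun p : ℕ => bMin (b p) ^ 2) =O[atTop] (fun _ : ℕ => (1 : ℝ))) :
    -- achievability, under any one of (i), (ii), (iii), (iv)
    -- (i)
    (((fun p : ℕ => (k p : ℝ)) =Θ[atTop] (fun _ : ℕ => (1 : ℝ)) ∨
      -- (ii)
      ((fun p : ℕ => (k p : ℝ)) =o[atTop] (fun p : ℕ => Real.log p) ∧
        (fun p : ℕ => (numDistinct (b p) : ℝ)) =Θ[atTop] (fun _ : ℕ => (1 : ℝ))) ∨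
      -- (iii)
      ((∃ θ : ℝ, 0 < θ ∧
          (fun p : ℕ => (k p : ℝ)) =O[atTop] (fun p : ℕ => Real.log p ^ θ)) ∧
        ∀ᶠ p in atTop, numDistinct (b p) = 1) ∨
      -- (iv)
      ((∃ θ : ℝ, 0 < θ ∧ θ < 1 ∧
          (fun p : ℕ => (k p : ℝ)) =Θ[atTop] (fun p : ℕ => (p : ℝ) ^ θ)) ∧
        (fun p : ℕ => bMin (b p) ^ 2) =Θ[atTop]
          (fun p : ℕ => Real.log (k p) / (k p : ℝ)) ∧
        ∀ᶠ p in atTop, numDistinct (b p) = 1)) →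
      ∀ (n : ℕ → ℕ) (η : ℝ), 0 < η →
        (∀ᶠ p in atTop, achThreshold p (σ p) (b p) * (1 + η) ≤ (n p : ℝ)) →
        ∃ d : (p : ℕ) → Decoder p (n p),
          Tendsto (fun p => errorProb (σ p) (b p) (d p)) atTop (𝓝 0)) ∧
    -- strong converse, without any of the conditions (i)-(iv)
    (∀ (n : ℕ → ℕ) (η : ℝ), 0 < η →
        (∀ᶠ p in atTop, (n p : ℝ) ≤ convThreshold p (σ p) (b p) * (1 - η)) →
        ∀ d : (p : ℕ) → Decoder p (n p),
          Tendsto (fun p => errorProb (σ p) (b p) (d p)) atTop (𝓝 1)) := by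
  have hkp : ∀ᶠ p in atTop, 2 * k p ≤ p := by
    filter_upwards [hk.bound (show (0 : ℝ) < 1 / 2 by norm_num)] with p hp
    rw [Real.norm_natCast, Real.norm_natCast] at hp
    have : 2 * (k p : ℝ) ≤ p := by linarith
    exact_mod_cast this
  constructor
  · intro hcases n η hη hn
    have hn1 : ∀ᶠ p in atTop, ∀ t : Finset (Fin (k p)), t.Nonempty →
        (1 + η) * Real.log ((p - k p).choose t.card) ≤ n p * information (σ p) (b p) t := by
      filter_upwards [hn, hσ_pos, hb_pos] with p h1 h2 h3 t ht
      have hI := information_pos h2 h3 ht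
      have h4 := log_choose_div_information_le_achThreshold p (σ p) (b p) ht
      rw [← div_le_iff₀ hI, mul_div_assoc, mul_comm]
      exact (mul_le_mul_of_nonneg_right h4 (by linarith)).trans h1
    have hn2 : ∀ᶠ p in atTop, ∀ t : Finset (Fin (k p)), t.Nonempty →
        Real.log ((p - k p).choose t.card) ≤ n p * information (σ p) (b p) t := by
      filter_upwards [hn1] with p h1 t ht
      refine le_trans (le_mul_of_one_le_left (Real.log_natCast_nonneg _) ?_) (h1 t ht)
      linarith
    refine exists_tendsto_errorProb_zero hη hkp hσ_pos hn1 ?_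
    rcases hcases with h | ⟨h, hm⟩ | ⟨⟨θ, -, h⟩, hm⟩ | ⟨⟨θ, hθ, hθ1, h⟩, hb, hm⟩
    · -- bounded supports have boundedly many distinct entries
      refine unionBoundsNegligible_of_isLittleO_log ?_ ?_ hn2
      · refine h.isBigO.trans_isLittleO ((isLittleO_const_left_of_ne one_ne_zero).2 ?_)
        exact tendsto_norm_atTop_atTop.comp tendsto_log_natCast
      · refine (IsBigO.of_bound 1 (Eventually.of_forall fun p => ?_)).trans h.isBigO
        rw [Real.norm_natCast, Real.norm_natCast, one_mul]
        have : numDistinct (b p) ≤ k p := by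
          rw [numDistinct, ← Set.image_univ]
          refine (Set.ncard_image_le Set.finite_univ).trans ?_
          rw [Set.ncard_univ, Nat.card_fin]
        exact_mod_cast this
    · exact unionBoundsNegligible_of_isLittleO_log h hm.isBigO hn2
    · exact unionBoundsNegligible_of_isBigO_log_rpow h hm hn2
    · exact unionBoundsNegligible_of_isTheta_rpow hθ hθ1 h
        (hkp.mono fun p hp => by omega) hσ hb hm hn2
  · intro n η hη hn d
    refine tendsto_errorProb_one (η := min η 1) (by positivity) (min_le_right _ _) hkp hσ_pos ?_ d
    filter_upwards [hn, hk_pos, hσ_pos, hb_pos] with p h1 h2 h3 h4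
    obtain ⟨t, ht, hmax⟩ := exists_convThreshold_eq p h2 (σ p) (b p)
    have hI := information_pos h3 h4 ht
    refine ⟨t, ht, ?_⟩
    rw [hmax, div_mul_eq_mul_div, le_div_iff₀ hI] at h1
    refine h1.trans ?_
    rw [mul_comm]
    refine mul_le_mul_of_nonneg_right ?_ (Real.log_natCast_nonneg _)
    linarith [min_le_left η 1]
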